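/- Let $S^2\subset\mathbb R^3$ be the unit sphere with round metric $\bar\gamma$, Levi-Civita derivative $\bar D$ and area element $\sqrt{\bar\gamma}\,d^2S$. *Boundary data.* Let $\mathfrak b$ be the real vector space of quadruples $(f,W,Y,I)$, where $f,W$ are smooth real functions on $S^2$, $I$ is a smooth vector field on $S^2$ and $Y$ is a smooth Killing vector field on $S^2$, with the bracket $[(f_1,W_1,Y_1,I_1),(f_2,W_2,Y_2,I_2)]=(\hat f,\hat W,\hat Y,\hat I)$, $$\hat f=Y_1^A\partial_A f_2-(1\leftrightarrow2),\qquad \hat W=Y_1^A\partial_A W_2-(1\leftrightarrow2),$$ $$\hat Y^A=Y_1^B\bar D_BY_2^A-(1\leftrightarrow2),\qquad \hat I^A=Y_1^B\bar D_BI_2^A+I_1^B\bar D_BY_2^A-(1\leftrightarrow2).$$ *Smearing fields.* Let $\mathfrak g$ be the real vector space of pairs $\xi^\mu=(\xi,\vec\xi)$ of a smooth function and a smooth vector field on $\mathbb R^3$ such that, as $r\to\infty$, $$\xi=f+O(r^{-1}),\qquad \xi^r=W+O(r^{-1}),\qquad \xi^A=Y^A+\tfrac1r I^A+O(r^{-2})$$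 for some $(f,W,Y,I)\in\mathfrak b$, with expansions in integer powers of $1/r$ (that is, near infinity $\xi,\xi^r,\xi^A$ are smooth functions of $1/r$, up to $1/r=0$, and of the direction). Equip $\mathfrak g$ with the bracket $$[\xi_1^\mu,\xi_2^\mu]=\bigl(\xi_1^i\partial_i\xi_2-\xi_2^i\partial_i\xi_1,\ [\vec\xi_1,\vec\xi_2]\bigr).$$ *Central term.* For a fixed choice of the sign $\mp$ put $$\omega(\xi_1^\mu,\xi_2^\mu)=\mp2\oint_{S^2}d^2S\,\sqrt{\bar\gamma}\,\Bigl(f_2\bigl(\bar D^A\bar D_AW_1-\bar D_AI_1^A\bigr)-f_1\bigl(\bar D^A\bar D_AW_2-\bar D_AI_2^A\bigr)\Bigr),$$ where $(f_i,W_i,Y_i,I_i)$ are the boundary data of $\xi_i^\mu$; the same formula defines $\omega$ on $\mathfrak b$. *Theorem.* The brackets are well defined and make $\mathfrak g$ and $\mathfrak b$ real Lie algebras; an element of $\mathfrak g$ determines its boundary data, and the map $\mathfrak g\to\mathfrak b$ to the boundary data is a Lie algebra homomorphism. On $\mathfrak b$ and on $\mathfrak g$ the form $\omega$ is bilinear and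 is a 2-cocycle: $$\omega(x,y)=-\omega(y,x),\qquad \omega([x,y],z)+\omega([y,z],x)+\omega([z,x],y)=0 .$$ Consequently $[x+\alpha c,y+\beta c]=[x,y]+\omega(x,y)\,c$ makes $\mathfrak g\oplus\mathbb Rc$ (and likewise $\mathfrak b\oplus\mathbb Rc$) a Lie algebra in which $c$ is central, and which projects homomorphically onto $\mathfrak g$ (respectively $\mathfrak b$). -/

import Mathlib

open scoped Manifold ContDiff RealInnerProductSpace

noncomputable section

namespace DustSymmetry

/-! ### The unit sphere and its Levi-Civita calculus -/

/-- Euclidean three-space, the dust space with its asymptotically Cartesian coordinates. -/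
abbrev E3 := EuclideanSpace ℝ (Fin 3)

/-- The unit sphere `S²`, with Mathlib's smooth structure. -/
abbrev S2 := Metric.sphere (0 : E3) 1

instance factFinrankE3 : Fact (Module.finrank ℝ E3 = 2 + 1) := ⟨by simp⟩

/-- A smooth map from the sphere to a normed space. -/
def SmoothS2 {V : Type} [NormedAddCommGroup V] [NormedSpace ℝ V] (g : S2 → V) : Prop :=
  ContMDiff (𝓡 2) 𝓘(ℝ, V) ∞ g

/-- The extension of a map on the sphere to `ℝ³ ∖ {0}` that is constant along rays
(with the irrelevant value `0` at the origin). -/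
def radialExt {V : Type} [Zero V] (g : S2 → V) (x : E3) : V :=
  open Classical in
  if h : x = 0 then 0
  else g ⟨‖x‖⁻¹ • x, by simp [norm_smul, norm_ne_zero_iff.mpr h]⟩

/-- The differential of a map on the sphere at `n`, as a linear map on `ℝ³`: on vectors tangent
to the sphere at `n` it is the differential, and it kills the normal vector `n`. -/
def dS {V : Type} [NormedAddCommGroup V] [NormedSpace ℝ V] (g : S2 → V) (n : S2) : E3 →L[ℝ] V :=
  fderiv ℝ (radialExt g) n

/-- Orthogonal projection of `ℝ³` onto the tangent plane of the sphere at `n`. -/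
def tangentProj (n : S2) : E3 →L[ℝ] E3 :=
  ContinuousLinearMap.id ℝ E3 - (innerSL ℝ (n : E3)).smulRight (n : E3)

/-- The field `V`, given by its values in `ℝ³`, is tangent to the sphere. -/
def IsTangent (V : S2 → E3) : Prop := ∀ n : S2, ⟪(n : E3), V n⟫ = 0

/-- The Levi-Civita covariant derivative `u ↦ D_u V` of a tangent vector field on the round sphere:
the tangential part of the derivative in `ℝ³`. It vanishes for `u` normal to the sphere. -/
def covDeriv (V : S2 → E3) (n : S2) : E3 →L[ℝ] E3 := (tangentProj n).comp (dS V n)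

/-- The gradient `D^A W` of a function on the sphere. -/
def gradS (W : S2 → ℝ) (n : S2) : E3 := gradient (radialExt W) (n : E3)

/-- The divergence `D_A V^A` of a tangent vector field: the trace of its covariant derivative (the
trace over `ℝ³` equals the trace over the tangent plane, as `covDeriv V n` kills the normal
vector and is tangent-valued). -/
def divS (V : S2 → E3) (n : S2) : ℝ := LinearMap.trace ℝ E3 (covDeriv V n : E3 →ₗ[ℝ] E3)

/-- The Laplace-Beltrami operator `D^A D_A W`. -/
def laplS (W : S2 → ℝ) (n : S2) : ℝ := divS (gradS W) n

/-- The Killing equation `D_A Y_B + D_B Y_A = 0` on the unit sphere. -/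
def IsKilling (Y : S2 → E3) : Prop :=
  ∀ (n : S2) (u v : E3), ⟪(n : E3), u⟫ = 0 → ⟪(n : E3), v⟫ = 0 →
    ⟪covDeriv Y n u, v⟫ + ⟪u, covDeriv Y n v⟫ = 0

/-- Integration against the area element of the unit sphere. -/
def integralS2 (g : S2 → ℝ) : ℝ := ∫ n, g n ∂((MeasureTheory.volume : MeasureTheory.Measure E3).toSphere)

/-! ### Boundary data -/

/-- Quadruples `(f, W, Y, I)` of two functions and two vector fields on the sphere. -/
abbrev BoundaryData := (S2 → ℝ) × (S2 → ℝ) × (S2 → E3) × (S2 → E3)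

namespace BoundaryData

/-- The time supertranslation. -/
def f (d : BoundaryData) : S2 → ℝ := d.1
/-- The radial part of the spatial supertranslation. -/
def W (d : BoundaryData) : S2 → ℝ := d.2.1
/-- The rotation. -/
def Y (d : BoundaryData) : S2 → E3 := d.2.2.1
/-- The angular part of the spatial supertranslation. -/
def I (d : BoundaryData) : S2 → E3 := d.2.2.2

/-- Admissible boundary data: `f`, `W` are smooth functions, `I` is a smooth vector field
and `Y` is a smooth Killing vector field. -/
structure IsAdmissible (d : BoundaryData) : Prop where
  smooth_f : SmoothS2 d.f
  smooth_W : SmoothS2 d.W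
  smooth_Y : SmoothS2 d.Y
  smooth_I : SmoothS2 d.I
  tangent_Y : IsTangent d.Y
  tangent_I : IsTangent d.I
  killing_Y : IsKilling d.Y

/-- The commutator of boundary data. -/
def bracket (d e : BoundaryData) : BoundaryData :=
  (fun n => dS e.f n (d.Y n) - dS d.f n (e.Y n),
   fun n => dS e.W n (d.Y n) - dS d.W n (e.Y n),
   fun n => covDeriv e.Y n (d.Y n) - covDeriv d.Y n (e.Y n),
   fun n => (covDeriv e.I n (d.Y n) + covDeriv e.Y n (d.I n))
     - (covDeriv d.I n (e.Y n) + covDeriv d.Y n (e.I n)))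

/-- The central term
`∓ 2 ∮ ( f₂ (D^A D_A W₁ - D_A I₁^A) - f₁ (D^A D_A W₂ - D_A I₂^A) ) √γ d²S`;
the sign `s` is `1` for the upper sign and `-1` for the lower one. -/
def centralTerm (s : ℝ) (d₁ d₂ : BoundaryData) : ℝ :=
  -s * 2 * integralS2 (fun n =>
    d₂.f n * (laplS d₁.W n - divS d₁.I n) - d₁.f n * (laplS d₂.W n - divS d₂.I n))

end BoundaryData

/-! ### Smearing fields with their fall-off -/

/-- Pairs `ξ^μ = (ξ, ξ⃗)` of a function and a vector field on the dust space. -/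
abbrev SmearingField := (E3 → ℝ) × (E3 → E3)

namespace SmearingField

/-- The commutator `(ξ₁^i ∂_i ξ₂ - ξ₂^i ∂_i ξ₁, [ξ⃗₁, ξ⃗₂])`. -/
def bracket (a b : SmearingField) : SmearingField :=
  (fun x => fderiv ℝ b.1 x (a.2 x) - fderiv ℝ a.1 x (b.2 x), VectorField.lieBracket ℝ a.2 b.2)

/-- The fall-off `ξ = f + O(1/r)`, `ξ^r = W + O(1/r)`, `ξ^A = Y^A + I^A / r + O(1/r²)` as `r → ∞`,
with expansions in integer powers of `1/r`. Outside a ball, `ξ`, `ξ^r` and `ξ^A` are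
smooth functions `F`, `P`, `Q` of `s = 1/r` (up to and including `s = 0`) and of the direction `n`.
At the point `r n` the coordinate field `∂_r` is `n` and `∂_A` is `r` times the
coordinate field `∂_A` of the unit sphere at `n`, hence `ξ⃗ (r n) = ξ^r n + r ξ^A ∂_A n`. -/
def HasBoundaryData (a : SmearingField) (d : BoundaryData) : Prop :=
  ∃ (F P : ℝ × E3 → ℝ) (Q : ℝ × E3 → E3) (R : ℝ),
    ContDiff ℝ ∞ F ∧ ContDiff ℝ ∞ P ∧ ContDiff ℝ ∞ Q ∧ 0 < R ∧
    (∀ (r : ℝ) (n : S2), R < r →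
      a.1 (r • (n : E3)) = F (r⁻¹, n) ∧
      a.2 (r • (n : E3)) = P (r⁻¹, n) • (n : E3) + r • Q (r⁻¹, n) ∧
      ⟪(n : E3), Q (r⁻¹, n)⟫ = 0) ∧
    ∀ n : S2, F (0, n) = d.f n ∧ P (0, n) = d.W n ∧ Q (0, n) = d.Y n ∧
      HasDerivAt (fun s : ℝ => Q (s, n)) (d.I n) 0

/-- Smooth smearing fields that have the above fall-off with admissible boundary data. -/
structure IsAdmissible (a : SmearingField) : Prop where
  smooth_time : ContDiff ℝ ∞ a.1
  smooth_space : ContDiff ℝ ∞ a.2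
  falloff : ∃ d : BoundaryData, d.IsAdmissible ∧ HasBoundaryData a d

end SmearingField

/-! ### Both sets of fields are real vector spaces -/

theorem SmoothS2.contDiffAt_radialExt {V : Type} [NormedAddCommGroup V] [NormedSpace ℝ V]
    {g : S2 → V} (hg : SmoothS2 g) {x : E3} (hx : x ≠ 0) : ContDiffAt ℝ ∞ (radialExt g) x := by
  let U : TopologicalSpace.Opens E3 := ⟨{0}ᶜ, isOpen_compl_singleton⟩
  have hne : ∀ y : U, (y : E3) ≠ 0 := fun y => y.2
  have h1 : ContMDiff 𝓘(ℝ, E3) 𝓘(ℝ, E3) ∞ (fun y : U => ‖(y : E3)‖⁻¹ • (y : E3)) := by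
    intro y
    refine (contMDiffAt_subtype_iff (f := fun y : E3 => ‖y‖⁻¹ • y)).2 ?_
    exact (((contDiffAt_norm ℝ (hne y)).inv (norm_ne_zero_iff.2 (hne y))).smul
      contDiffAt_id).contMDiffAt
  have h2 : ∀ y : U, ‖(y : E3)‖⁻¹ • (y : E3) ∈ Metric.sphere (0 : E3) 1 := fun y => by
    simp [norm_smul, norm_ne_zero_iff.mpr (hne y)]
  have h3 : ContMDiff 𝓘(ℝ, E3) 𝓘(ℝ, V) ∞ (fun y : U => radialExt g (y : E3)) := by
    have := ContMDiff.comp hg (h1.codRestrict_sphere h2)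
    refine this.congr fun y => ?_
    simp only [radialExt, dif_neg (hne y)]
    rfl
  exact ((contMDiffAt_subtype_iff (U := U) (f := radialExt g) (x := ⟨x, hx⟩)).1
    (h3 ⟨x, hx⟩)).contDiffAt

theorem SmoothS2.differentiableAt_radialExt {V : Type} [NormedAddCommGroup V] [NormedSpace ℝ V]
    {g : S2 → V} (hg : SmoothS2 g) (n : S2) : DifferentiableAt ℝ (radialExt g) (n : E3) :=
  (hg.contDiffAt_radialExt (ne_zero_of_mem_unit_sphere n)).differentiableAt (by simp)

theorem dS_add {V : Type} [NormedAddCommGroup V] [NormedSpace ℝ V] {g h : S2 → V}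
    (hg : SmoothS2 g) (hh : SmoothS2 h) (n : S2) : dS (g + h) n = dS g n + dS h n := by
  have : radialExt (g + h) = radialExt g + radialExt h := by
    funext x
    by_cases hx : x = 0 <;> simp [radialExt, hx]
  rw [dS, this, fderiv_add (hg.differentiableAt_radialExt n) (hh.differentiableAt_radialExt n)]
  rfl

theorem dS_smul {V : Type} [NormedAddCommGroup V] [NormedSpace ℝ V] (c : ℝ) {g : S2 → V}
    (hg : SmoothS2 g) (n : S2) : dS (c • g) n = c • dS g n := by
  have : radialExt (c • g) = c • radialExt g := by
    funext x
    by_cases hx : x = 0 <;> simp [radialExt, hx]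
  rw [dS, this, fderiv_const_smul (hg.differentiableAt_radialExt n)]
  rfl

theorem dS_zero {V : Type} [NormedAddCommGroup V] [NormedSpace ℝ V] (n : S2) :
    dS (0 : S2 → V) n = 0 := by
  have : radialExt (0 : S2 → V) = fun _ => 0 := by
    funext x
    by_cases hx : x = 0 <;> simp [radialExt, hx]
  rw [dS, this]
  simp

theorem BoundaryData.IsAdmissible.zero : (0 : BoundaryData).IsAdmissible where
  smooth_f := contMDiff_const
  smooth_W := contMDiff_const
  smooth_Y := contMDiff_const
  smooth_I := contMDiff_const
  tangent_Y := fun n => inner_zero_right _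
  tangent_I := fun n => inner_zero_right _
  killing_Y := fun n u v _ _ => by
    have : dS (BoundaryData.Y 0) n = 0 := dS_zero n
    simp [covDeriv, this]

theorem BoundaryData.IsAdmissible.add {d e : BoundaryData} (hd : d.IsAdmissible)
    (he : e.IsAdmissible) : (d + e).IsAdmissible where
  smooth_f := ContMDiff.add hd.smooth_f he.smooth_f
  smooth_W := ContMDiff.add hd.smooth_W he.smooth_W
  smooth_Y := ContMDiff.add hd.smooth_Y he.smooth_Y
  smooth_I := ContMDiff.add hd.smooth_I he.smooth_I
  tangent_Y := fun n => by
    have h1 := hd.tangent_Y n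
    have h2 := he.tangent_Y n
    change ⟪(n : E3), d.Y n + e.Y n⟫ = 0
    rw [inner_add_right, h1, h2, add_zero]
  tangent_I := fun n => by
    have h1 := hd.tangent_I n
    have h2 := he.tangent_I n
    change ⟪(n : E3), d.I n + e.I n⟫ = 0
    rw [inner_add_right, h1, h2, add_zero]
  killing_Y := fun n u v hu hv => by
    have h : dS (BoundaryData.Y (d + e)) n = dS d.Y n + dS e.Y n :=
      dS_add hd.smooth_Y he.smooth_Y n
    have h1 := hd.killing_Y n u v hu hv
    have h2 := he.killing_Y n u v hu hv
    simp only [covDeriv, ContinuousLinearMap.comp_apply] at h1 h2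
    simp only [covDeriv, h, ContinuousLinearMap.comp_apply, add_apply, map_add,
      inner_add_left, inner_add_right]
    linarith

theorem BoundaryData.IsAdmissible.smul (c : ℝ) {d : BoundaryData} (hd : d.IsAdmissible) :
    (c • d).IsAdmissible where
  smooth_f := (contDiff_const_smul c).contMDiff.comp hd.smooth_f
  smooth_W := (contDiff_const_smul c).contMDiff.comp hd.smooth_W
  smooth_Y := (contDiff_const_smul c).contMDiff.comp hd.smooth_Y
  smooth_I := (contDiff_const_smul c).contMDiff.comp hd.smooth_I
  tangent_Y := fun n => by
    have h1 := hd.tangent_Y n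
    change ⟪(n : E3), c • d.Y n⟫ = 0
    rw [real_inner_smul_right, h1, mul_zero]
  tangent_I := fun n => by
    have h1 := hd.tangent_I n
    change ⟪(n : E3), c • d.I n⟫ = 0
    rw [real_inner_smul_right, h1, mul_zero]
  killing_Y := fun n u v hu hv => by
    have h : dS (BoundaryData.Y (c • d)) n = c • dS d.Y n := dS_smul c hd.smooth_Y n
    have h1 := hd.killing_Y n u v hu hv
    simp only [covDeriv, ContinuousLinearMap.comp_apply] at h1
    simp only [covDeriv, h, ContinuousLinearMap.comp_apply, smul_apply,
      map_smul, real_inner_smul_left, real_inner_smul_right]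
    rw [← mul_add, h1, mul_zero]

theorem SmearingField.HasBoundaryData.zero : SmearingField.HasBoundaryData 0 0 := by
  refine ⟨fun _ => 0, fun _ => 0, fun _ => 0, 1, contDiff_const, contDiff_const, contDiff_const,
    one_pos, fun r n _ => ⟨rfl, by simp, inner_zero_right _⟩, fun n => ⟨rfl, rfl, rfl, ?_⟩⟩
  exact hasDerivAt_const _ _

theorem SmearingField.HasBoundaryData.add {a b : SmearingField} {d e : BoundaryData}
    (ha : a.HasBoundaryData d) (hb : b.HasBoundaryData e) :
    SmearingField.HasBoundaryData (a + b) (d + e) := by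
  obtain ⟨F, P, Q, R, hF, hP, hQ, hR, h1, h2⟩ := ha
  obtain ⟨F', P', Q', R', hF', hP', hQ', hR', h1', h2'⟩ := hb
  refine ⟨F + F', P + P', Q + Q', max R R', hF.add hF', hP.add hP', hQ.add hQ',
    lt_max_of_lt_left hR, fun r n hr => ?_, fun n => ?_⟩
  · obtain ⟨k1, k2, k3⟩ := h1 r n ((le_max_left _ _).trans_lt hr)
    obtain ⟨k1', k2', k3'⟩ := h1' r n ((le_max_right _ _).trans_lt hr)
    refine ⟨congrArg₂ (· + ·) k1 k1', ?_, ?_⟩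
    · change a.2 (r • (n : E3)) + b.2 (r • (n : E3)) = _
      rw [k2, k2']
      simp only [Pi.add_apply, add_smul, smul_add]
      abel
    · rw [Pi.add_apply, inner_add_right, k3, k3', add_zero]
  · obtain ⟨k1, k2, k3, k4⟩ := h2 n
    obtain ⟨k1', k2', k3', k4'⟩ := h2' n
    exact ⟨congrArg₂ (· + ·) k1 k1', congrArg₂ (· + ·) k2 k2', congrArg₂ (· + ·) k3 k3',
      k4.add k4'⟩

theorem SmearingField.HasBoundaryData.smul (c : ℝ) {a : SmearingField} {d : BoundaryData}
    (ha : a.HasBoundaryData d) : SmearingField.HasBoundaryData (c • a) (c • d) := by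
  obtain ⟨F, P, Q, R, hF, hP, hQ, hR, h1, h2⟩ := ha
  refine ⟨c • F, c • P, c • Q, R, hF.const_smul c, hP.const_smul c, hQ.const_smul c,
    hR, fun r n hr => ?_, fun n => ?_⟩
  · obtain ⟨k1, k2, k3⟩ := h1 r n hr
    refine ⟨congrArg (c • ·) k1, ?_, ?_⟩
    · change c • a.2 (r • (n : E3)) = _
      rw [k2, smul_add, smul_smul, smul_comm c r]
      rfl
    · rw [Pi.smul_apply, real_inner_smul_right, k3, mul_zero]
  · obtain ⟨k1, k2, k3, k4⟩ := h2 n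
    exact ⟨congrArg (c • ·) k1, congrArg (c • ·) k2, congrArg (c • ·) k3, k4.const_smul c⟩

/-- The real vector space of admissible boundary data. -/
def boundarySpace : Submodule ℝ BoundaryData where
  carrier := {d | d.IsAdmissible}
  zero_mem' := BoundaryData.IsAdmissible.zero
  add_mem' := fun hd he => BoundaryData.IsAdmissible.add hd he
  smul_mem' := fun c _ hd => BoundaryData.IsAdmissible.smul c hd

/-- The real vector space of smearing fields `ξ^μ` of the boundary-preserving charges. -/
def smearingSpace : Submodule ℝ SmearingField where
  carrier := {a | a.IsAdmissible}
  zero_mem' := ⟨contDiff_const, contDiff_const, 0, BoundaryData.IsAdmissible.zero,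
    SmearingField.HasBoundaryData.zero⟩
  add_mem' := by
    rintro a b ⟨ha1, ha2, d, hd, had⟩ ⟨hb1, hb2, e, he, hbe⟩
    exact ⟨ha1.add hb1, ha2.add hb2, d + e, hd.add he, had.add hbe⟩
  smul_mem' := by
    rintro c a ⟨ha1, ha2, d, hd, had⟩
    exact ⟨ha1.const_smul c, ha2.const_smul c, c • d, hd.smul c, had.smul c⟩

/-! ### Lie brackets, 2-cocycles and central extensions -/

section Lie

variable {L : Type} [AddCommGroup L] [Module ℝ L]

/-- The bilinear map `br` is a Lie bracket. -/
structure IsLieBracket (br : L →ₗ[ℝ] L →ₗ[ℝ] L) : Prop where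
  alternating : ∀ x, br x x = 0
  jacobi : ∀ x y z, br (br x y) z + br (br y z) x + br (br z x) y = 0

/-- The bilinear form `Ω` is a 2-cocycle for the bracket `br`. -/
structure IsTwoCocycle (br : L →ₗ[ℝ] L →ₗ[ℝ] L) (Ω : L →ₗ[ℝ] L →ₗ[ℝ] ℝ) : Prop where
  antisymmetric : ∀ x y, Ω x y = -Ω y x
  cocycle : ∀ x y z, Ω (br x y) z + Ω (br y z) x + Ω (br z x) y = 0

/-- The bracket `[x + α c, y + β c] = [x, y] + Ω(x, y) c` on `L ⊕ ℝ c`. -/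
def extensionBracket (br : L →ₗ[ℝ] L →ₗ[ℝ] L) (Ω : L →ₗ[ℝ] L →ₗ[ℝ] ℝ) :
    (L × ℝ) →ₗ[ℝ] (L × ℝ) →ₗ[ℝ] (L × ℝ) :=
  LinearMap.mk₂ ℝ (fun x y => (br x.1 y.1, Ω x.1 y.1))
    (by intros; simp) (by intros; simp) (by intros; simp) (by intros; simp)

/-- `Ω` defines a central extension of the Lie algebra `(L, br)` by `ℝ c`. -/
structure IsCentralExtension (br : L →ₗ[ℝ] L →ₗ[ℝ] L) (Ω : L →ₗ[ℝ] L →ₗ[ℝ] ℝ) : Prop where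
  base : IsLieBracket br
  extension : IsLieBracket (extensionBracket br Ω)
  central : ∀ (c : ℝ) (x : L × ℝ), extensionBracket br Ω (0, c) x = 0
  projection : ∀ x y : L × ℝ, (extensionBracket br Ω x y).1 = br x.1 y.1

end Lie

end DustSymmetry

end

open DustSymmetry

namespace DustSymmetry

/-! ### Maps on the sphere and their extensions to `ℝ³` -/

section Radial

variable {V : Type}

/-! The engine is that a Killing field of the unit sphere is a rotation, `Y n = A n` with `A` a skew
endomorphism of `ℝ³` (`IsKilling.exists_isSkew`). Its degree-1 extension `‖x‖ Y(x/‖x‖)` has skew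
derivative, which forces the second derivative to vanish.

The bracket of the `I`-parts is the difference of Lie derivatives `L_{Y₁} I₂ - L_{Y₂} I₁`. Rotations
are isometries, so Lie derivatives along them commute with gradient and divergence
(`gradS_rotation`, `divS_rotation`). Hence the flux `Φ = div (grad W - I)` obeys the same law as
`f`, namely `Φ₁₂ = Y₁Φ₂ - Y₂Φ₁` (`flux_bracket`). Since `∮ Y(g) = 0` for a rotation
(`integralS2_rotation_eq_zero`), the cocycle identity for `∮ (f₂Φ₁ - f₁Φ₂)` is a sum of integrations
by parts.

For smearing fields, put `s = 1/r`. Differentiation along `ξ⃗` becomes `-s² ξ^r ∂_s + ξ^A ∂_A`,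
whose coefficients are smooth up to `s = 0`; so expansions are stable under the bracket, and orders
`s⁰` and `s¹` reproduce the boundary bracket (`HasLimit.bracket`). Jacobi for the pairs `(ξ, ξ⃗)` is
Jacobi for vector fields on `ℝ³ × ℝ` independent of the last coordinate. The map to boundary data is
surjective, so bilinearity and Jacobi descend to the boundary data, while the cocycle pulls back to
smearing fields; the central extensions then follow formally. -/

theorem radialExt_coe [Zero V] (g : S2 → V) (n : S2) : radialExt g (n : E3) = g n := by
  rw [radialExt, dif_neg (ne_zero_of_mem_unit_sphere n)]
  congr 1
  ext1
  simp

theorem radialExt_smul [Zero V] (g : S2 → V) {r : ℝ} (hr : 0 < r) (x : E3) :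
    radialExt g (r • x) = radialExt g x := by
  by_cases hx : x = 0
  · simp [hx]
  · rw [radialExt, radialExt, dif_neg hx, dif_neg (smul_ne_zero hr.ne' hx)]
    congr 2
    rw [norm_smul, Real.norm_of_nonneg hr.le, mul_inv, smul_smul, mul_right_comm,
      inv_mul_cancel₀ hr.ne', one_mul]

theorem exists_eq_norm_smul {x : E3} (hx : x ≠ 0) : ∃ n : S2, x = ‖x‖ • (n : E3) :=
  ⟨⟨‖x‖⁻¹ • x, by simp [norm_smul, norm_ne_zero_iff.mpr hx]⟩,
    (smul_inv_smul₀ (norm_ne_zero_iff.mpr hx) x).symm⟩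

/-- A function that is constant along rays and agrees with `g` on the sphere is the radial
extension of `g`. -/
theorem eq_radialExt [Zero V] {g : S2 → V} {G : E3 → V} (h0 : G 0 = 0)
    (h : ∀ (r : ℝ) (n : S2), 0 < r → G (r • (n : E3)) = g n) : G = radialExt g := by
  funext x
  by_cases hx : x = 0
  · simp [hx, h0, radialExt]
  · obtain ⟨n, hn⟩ := exists_eq_norm_smul hx
    rw [hn, h _ n (norm_pos_iff.mpr hx), radialExt_smul g (norm_pos_iff.mpr hx), radialExt_coe]

/-- Polar coordinates at infinity `x ↦ (1/r, x/r)`. -/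
noncomputable def polar (x : E3) : ℝ × E3 := (‖x‖⁻¹, ‖x‖⁻¹ • x)

theorem polar_smul {r : ℝ} (hr : 0 < r) (n : S2) : polar (r • (n : E3)) = (r⁻¹, (n : E3)) := by
  simp [polar, norm_smul, abs_of_pos hr, smul_smul, inv_mul_cancel₀ hr.ne']

theorem radialExt_restrict_eventuallyEq [Zero V] (G : E3 → V) (n : S2) :
    radialExt (fun m : S2 => G m) =ᶠ[nhds (n : E3)] fun x => G (polar x).2 := by
  filter_upwards [isOpen_compl_singleton.mem_nhds (ne_zero_of_mem_unit_sphere n)] with x hx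
  exact dif_neg hx

variable [NormedAddCommGroup V] [NormedSpace ℝ V]

/-- An extension of degree 0 has a derivative of degree -1; no differentiability is needed, because
`fderiv_comp_smul` is unconditional. -/
theorem fderiv_radialExt_smul (g : S2 → V) {r : ℝ} (hr : 0 < r) (x : E3) :
    fderiv ℝ (radialExt g) (r • x) = r⁻¹ • fderiv ℝ (radialExt g) x := by
  have h := fderiv_comp_smul (𝕜 := ℝ) (f := radialExt g) (x := x) r
  rw [show (fun x => radialExt g (r • x)) = radialExt g from
    funext fun x => radialExt_smul g hr x] at h
  rw [h, inv_smul_smul₀ hr.ne']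

theorem fderiv_radialExt_self (g : S2 → V) (x : E3) : fderiv ℝ (radialExt g) x x = 0 := by
  by_cases hd : DifferentiableAt ℝ (radialExt g) x
  · have h1 : HasLineDerivAt ℝ (radialExt g) (fderiv ℝ (radialExt g) x x) x x :=
      hd.hasFDerivAt.hasLineDerivAt x
    have h2 : HasLineDerivAt ℝ (radialExt g) 0 x x := by
      refine (hasDerivAt_const (0 : ℝ) (radialExt g x)).congr_of_eventuallyEq ?_
      filter_upwards [lt_mem_nhds (show (-1 : ℝ) < 0 by norm_num)] with t ht
      rw [show x + t • x = (1 + t) • x by rw [add_smul, one_smul],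
        radialExt_smul g (by linarith)]
    exact h1.unique h2
  -- Without differentiability `fderiv` takes its default value `0`, so Euler's relation still
  -- holds.
  · rw [fderiv_zero_of_not_differentiableAt hd]
    rfl

theorem inner_coe_self (n : S2) : ⟪(n : E3), (n : E3)⟫ = 1 := by
  rw [real_inner_self_eq_norm_sq]
  simp

theorem tangentProj_apply (n : S2) (u : E3) :
    tangentProj n u = u - ⟪(n : E3), u⟫ • (n : E3) := by
  simp [tangentProj]

theorem tangentProj_of_inner_eq_zero {n : S2} {u : E3} (hu : ⟪(n : E3), u⟫ = 0) :
    tangentProj n u = u := by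
  rw [tangentProj_apply, hu, zero_smul, sub_zero]

theorem dS_self (g : S2 → V) (n : S2) : dS g n n = 0 := fderiv_radialExt_self g n

theorem hasFDerivAt_norm_smul_coe {r : ℝ} (hr : 0 < r) (n : S2) :
    HasFDerivAt (fun x : E3 => ‖x‖) (innerSL ℝ (n : E3)) (r • (n : E3)) := by
  have hx : r • (n : E3) ≠ 0 := smul_ne_zero hr.ne' (ne_zero_of_mem_unit_sphere n)
  have h := ((hasStrictFDerivAt_norm_sq (r • (n : E3))).hasFDerivAt).sqrt
    (pow_ne_zero 2 (norm_ne_zero_iff.mpr hx))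
  simp only [Real.sqrt_sq (norm_nonneg _)] at h
  refine h.congr_fderiv ?_
  have : ‖r • (n : E3)‖ = r := by simp [norm_smul, abs_of_pos hr]
  rw [this]
  ext v
  simp
  field_simp

/-- Radial motion changes only `1/r`, at rate `-r⁻²`; tangential motion changes only the direction,
at rate `r⁻¹`. -/
theorem hasFDerivAt_polar {r : ℝ} (hr : 0 < r) (n : S2) :
    HasFDerivAt polar ((-(r⁻¹ ^ 2) • innerSL ℝ (n : E3)).prod (r⁻¹ • tangentProj n))
      (r • (n : E3)) := by
  have hn : ‖r • (n : E3)‖ = r := by simp [norm_smul, abs_of_pos hr]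
  have h1 : HasFDerivAt (fun x : E3 => ‖x‖⁻¹) (-(r⁻¹ ^ 2) • innerSL ℝ (n : E3))
      (r • (n : E3)) := by
    have h := (hasDerivAt_inv (hn.symm ▸ hr.ne')).comp_hasFDerivAt _ (hasFDerivAt_norm_smul_coe hr n)
    rw [hn] at h
    simpa [Function.comp_def] using h
  refine h1.prodMk ?_
  refine (h1.smul (hasFDerivAt_id (r • (n : E3)))).congr_fderiv ?_
  ext1 v
  simp only [hn, tangentProj, smul_apply, sub_apply, add_apply, ContinuousLinearMap.id_apply,
    ContinuousLinearMap.smulRight_apply, innerSL_apply_apply, id_eq, smul_sub, smul_smul,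
    smul_eq_mul]
  rw [sub_eq_add_neg, ← neg_smul]
  congr 2
  field_simp

/-- The derivative of a function of `(1/r, x/r)` in the direction `p ∂_r + q^A ∂_A`. -/
theorem fderiv_comp_polar {G : ℝ × E3 → V} {r : ℝ} (hr : 0 < r) {n : S2}
    (hG : DifferentiableAt ℝ G (r⁻¹, (n : E3))) (p : ℝ) {q : E3} (hq : ⟪(n : E3), q⟫ = 0) :
    fderiv ℝ (fun x => G (polar x)) (r • (n : E3)) (p • (n : E3) + r • q) =
      fderiv ℝ G (r⁻¹, (n : E3)) (-(r⁻¹ ^ 2 * p), q) := by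
  have h := (polar_smul hr n ▸ hG).hasFDerivAt.comp _ (hasFDerivAt_polar hr n)
  rw [polar_smul hr n] at h
  change fderiv ℝ (G ∘ polar) _ _ = _
  rw [h.fderiv]
  simp [tangentProj_apply, inner_add_right, inner_smul_right, hq,
    inv_smul_smul₀ hr.ne']

/-- The ray-constant extension of a restriction is `G` composed with `x ↦ x/‖x‖`, whose derivative
at `n` is the tangential projection. Thus `dS` can be computed from any differentiable extension. -/
theorem dS_restrict {G : E3 → V} {n : S2} (hG : DifferentiableAt ℝ G n) :
    dS (fun m : S2 => G m) n = (fderiv ℝ G n).comp (tangentProj n) := by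
  rw [dS, (radialExt_restrict_eventuallyEq G n).fderiv_eq]
  have h1 := (hasFDerivAt_polar one_pos n).snd
  rw [one_smul] at h1
  have h2 : (polar (n : E3)).2 = n := by simp [polar]
  have h := (h2.symm ▸ hG.hasFDerivAt : HasFDerivAt G (fderiv ℝ G n) _).comp _ h1
  refine h.fderiv.trans ?_
  ext v
  simp

theorem dS_restrict_apply {G : E3 → V} {n : S2} (hG : DifferentiableAt ℝ G n) {u : E3}
    (hu : ⟪(n : E3), u⟫ = 0) : dS (fun m : S2 => G m) n u = fderiv ℝ G n u := by
  rw [dS_restrict hG, ContinuousLinearMap.comp_apply, tangentProj_of_inner_eq_zero hu]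

theorem smoothS2_restrict {G : E3 → V} (hG : ∀ n : S2, ContDiffAt ℝ ∞ G n) :
    SmoothS2 (fun m : S2 => G m) := fun n =>
  (hG n).contMDiffAt.comp n (contMDiff_coe_sphere (n := 2)).contMDiffAt

/-- A smooth map on the sphere is extended constantly along rays outside the unit ball
by a smooth map on `ℝ³`. -/
theorem SmoothS2.exists_contDiff {g : S2 → V} (hg : SmoothS2 g) :
    ∃ G : E3 → V, ContDiff ℝ ∞ G ∧ ∀ (r : ℝ) (n : S2), 1 ≤ r → G (r • (n : E3)) = g n := by
  -- The cutoff vanishes for `‖x‖² ≤ 1/2` and equals 1 for `‖x‖ ≥ 1`; using `‖x‖²` keeps it smooth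
  -- at the origin.
  refine ⟨fun x => Real.smoothTransition (2 * ‖x‖ ^ 2 - 1) • radialExt g x, ?_, ?_⟩
  · rw [contDiff_iff_contDiffAt]
    intro x
    by_cases hx : x = 0
    · refine (contDiffAt_const (c := (0 : V))).congr_of_eventuallyEq ?_
      have hc : Continuous fun y : E3 => 2 * ‖y‖ ^ 2 - 1 := by fun_prop
      filter_upwards [hc.continuousAt.eventually_lt_const
        (show 2 * ‖x‖ ^ 2 - 1 < (0 : ℝ) by simp [hx])] with y hy
      rw [Real.smoothTransition.zero_of_nonpos hy.le, zero_smul]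
    · refine ContDiffAt.smul ?_ (hg.contDiffAt_radialExt hx)
      exact Real.smoothTransition.contDiffAt.comp x
        ((contDiffAt_const.mul (contDiff_norm_sq ℝ).contDiffAt).sub contDiffAt_const)
  · intro r n hr
    have h0 : 0 < r := one_pos.trans_le hr
    have : ‖r • (n : E3)‖ = r := by simp [norm_smul, abs_of_pos h0]
    simp only [this]
    rw [Real.smoothTransition.one_of_one_le (by nlinarith), one_smul, radialExt_smul g h0,
      radialExt_coe]

/-- Differentiate `⟪x, Y⟫ = 0`, which the ray-constant extension satisfies on all of `ℝ³`. The right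
side is symmetric in `u` and `Y`, so normal components cancel in brackets. -/
theorem inner_dS_of_isTangent {Y : S2 → E3} (hs : SmoothS2 Y) (hY : IsTangent Y) (n : S2) (u : E3) :
    ⟪(n : E3), dS Y n u⟫ = -⟪u, Y n⟫ := by
  have h1 := ((hasFDerivAt_id (n : E3)).inner ℝ
    (hs.differentiableAt_radialExt n).hasFDerivAt).fderiv
  have h2 : (fun x : E3 => ⟪id x, radialExt Y x⟫) = fun _ => 0 := by
    funext x
    by_cases hx : x = 0
    · simp [hx]
    · obtain ⟨m, hm⟩ := exists_eq_norm_smul hx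
      rw [hm, radialExt_smul _ (norm_pos_iff.mpr hx), radialExt_coe, id, real_inner_smul_left,
        hY m, mul_zero]
  rw [h2] at h1
  have h3 := congrArg (fun L : E3 →L[ℝ] ℝ => L u) h1
  simp [radialExt_coe] at h3
  change ⟪(n : E3), fderiv ℝ (radialExt Y) n u⟫ = _
  linarith

end Radial

/-! ### Killing fields of the round sphere are rotations -/

/-- A skew-symmetric endomorphism of `ℝ³`. -/
def IsSkew (A : E3 →L[ℝ] E3) : Prop := ∀ u v, ⟪A u, v⟫ = -⟪u, A v⟫

theorem IsSkew.inner_self {A : E3 →L[ℝ] E3} (hA : IsSkew A) (u : E3) : ⟪u, A u⟫ = 0 := by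
  have h := hA u u
  rw [real_inner_comm] at h
  linarith

/-! ### Second derivatives of smooth maps and their symmetry -/

section Calculus

variable {E F G : Type} [NormedAddCommGroup E] [NormedSpace ℝ E] [NormedAddCommGroup F]
  [NormedSpace ℝ F] [NormedAddCommGroup G] [NormedSpace ℝ G]

theorem fderiv_clm_apply_const {D : E → F →L[ℝ] G} {x : E} (hD : DifferentiableAt ℝ D x) (v : F)
    (u : E) : fderiv ℝ (fun y => D y v) x u = fderiv ℝ D x u v := by
  rw [(hD.hasFDerivAt.clm_apply (hasFDerivAt_const v x)).fderiv]
  simp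

theorem differentiableAt_fderiv_of_smooth {f : E → F} {x : E} (hf : ContDiffAt ℝ ∞ f x) :
    DifferentiableAt ℝ (fderiv ℝ f) x :=
  (hf.fderiv_right (m := ∞) (by simp)).differentiableAt (by simp)

theorem fderiv_fderiv_comm_of_smooth {f : E → F} {x : E} (hf : ContDiffAt ℝ ∞ f x) (u v : E) :
    fderiv ℝ (fderiv ℝ f) x u v = fderiv ℝ (fderiv ℝ f) x v u :=
  hf.isSymmSndFDerivAt
    (by rw [minSmoothness_of_isRCLikeNormedField]; exact WithTop.coe_le_coe.2 le_top) u v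

end Calculus

/-- A vector field with skew-symmetric derivative has vanishing second derivative. -/
theorem fderiv_fderiv_eq_zero_of_skew {f : E3 → E3} {x : E3} (hf : ContDiffAt ℝ ∞ f x)
    (hs : ∀ᶠ y in nhds x, IsSkew (fderiv ℝ f y)) : fderiv ℝ (fderiv ℝ f) x = 0 := by
  have hD := differentiableAt_fderiv_of_smooth hf
  have skew : ∀ u v w, ⟪fderiv ℝ (fderiv ℝ f) x u v, w⟫ = -⟪fderiv ℝ (fderiv ℝ f) x u w, v⟫ := by
    intro u v w
    have h1 : HasFDerivAt (fun y => ⟪fderiv ℝ f y v, w⟫ + ⟪fderiv ℝ f y w, v⟫) _ x :=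
      ((hD.hasFDerivAt.clm_apply (hasFDerivAt_const v x)).inner ℝ (hasFDerivAt_const w x)).add
      ((hD.hasFDerivAt.clm_apply (hasFDerivAt_const w x)).inner ℝ (hasFDerivAt_const v x))
    have h2 : (fun y => ⟪fderiv ℝ f y v, w⟫ + ⟪fderiv ℝ f y w, v⟫) =ᶠ[nhds x] fun _ => 0 := by
      filter_upwards [hs] with y hy
      rw [hy v w, real_inner_comm]
      ring
    have h3 := congrArg (fun L : E3 →L[ℝ] ℝ => L u) (h1.fderiv.symm.trans h2.fderiv_eq)
    simp at h3
    linarith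
  have comm := fderiv_fderiv_comm_of_smooth hf
  ext1 u
  ext1 v
  refine ext_inner_right ℝ fun w => ?_
  -- A trilinear form symmetric in the first two slots and skew in the last two vanishes: three
  -- swaps of each kind, alternated, restore the arguments with the sign `(-1)³`.
  have h1 := skew v u w
  have h2 := skew w v u
  have h3 := skew u w v
  rw [comm v w] at h1
  rw [comm w u] at h2
  rw [comm u v] at h3 ⊢
  rw [comm w v, comm v u] at *
  simp
  linarith

/-- The degree-1 extension is the one that turns a rotation `n ↦ A n` into the linear map `A`. Its
derivative has degree 0, hence does not depend on `r`. -/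
theorem hasFDerivAt_norm_smul_radialExt {Y : S2 → E3} (hs : SmoothS2 Y) {r : ℝ} (hr : 0 < r)
    (n : S2) : HasFDerivAt (fun x => ‖x‖ • radialExt Y x)
      (dS Y n + (innerSL ℝ (n : E3)).smulRight (Y n)) (r • (n : E3)) := by
  have hx : r • (n : E3) ≠ 0 := smul_ne_zero hr.ne' (ne_zero_of_mem_unit_sphere n)
  have h := (hasFDerivAt_norm_smul_coe hr n).smul
    ((hs.contDiffAt_radialExt hx).differentiableAt (by simp)).hasFDerivAt
  refine h.congr_fderiv ?_
  rw [radialExt_smul Y hr, radialExt_coe, fderiv_radialExt_smul Y hr, norm_smul,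
    Real.norm_of_nonneg hr.le]
  simp [smul_smul, mul_inv_cancel₀ hr.ne', dS]

/-- On the tangent plane this is the Killing equation. In the mixed slots the normal component `-⟪u,
Y n⟫` of `dS Y n u` cancels the term `⟪n, v⟫⟪u, Y n⟫` at `v = n`, and the normal-normal entry is
`⟪n, Y n⟫ = 0`. -/
theorem IsKilling.isSkew {Y : S2 → E3} (hs : SmoothS2 Y) (ht : IsTangent Y) (hk : IsKilling Y)
    (n : S2) : IsSkew (dS Y n + (innerSL ℝ (n : E3)).smulRight (Y n)) := by
  intro u v
  have hn : ∀ w, ⟪(n : E3), tangentProj n w⟫ = 0 := fun w => by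
    rw [tangentProj_apply, inner_sub_right, real_inner_smul_right, inner_coe_self, mul_one,
      sub_self]
  have hd : ∀ w, dS Y n (tangentProj n w) = dS Y n w := fun w => by
    rw [tangentProj_apply, map_sub, map_smul, dS_self, smul_zero, sub_zero]
  have h := hk n _ _ (hn u) (hn v)
  simp only [covDeriv, ContinuousLinearMap.comp_apply, hd] at h
  simp only [tangentProj_apply, inner_sub_left, inner_sub_right, real_inner_smul_left,
    real_inner_smul_right, inner_dS_of_isTangent hs ht, inner_coe_self] at h
  have e1 : ⟪dS Y n u, (n : E3)⟫ = -⟪u, Y n⟫ := by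
    rw [real_inner_comm, inner_dS_of_isTangent hs ht]
  simp only [add_apply, ContinuousLinearMap.smulRight_apply, innerSL_apply_apply, inner_add_left,
    inner_add_right, real_inner_smul_left, real_inner_smul_right]
  rw [e1, real_inner_comm (n : E3) u] at h
  rw [real_inner_comm v (Y n)]
  linarith

/-- A Killing vector field of the unit sphere is an infinitesimal rotation. -/
theorem IsKilling.exists_isSkew {Y : S2 → E3} (hs : SmoothS2 Y) (ht : IsTangent Y)
    (hk : IsKilling Y) : ∃ A : E3 →L[ℝ] E3, IsSkew A ∧ ∀ n : S2, Y n = A n := by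
  set f : E3 → E3 := fun x => ‖x‖ • radialExt Y x with hf
  have hopen : IsOpen ({0}ᶜ : Set E3) := isOpen_compl_singleton
  have hsm : ∀ x : E3, x ≠ 0 → ContDiffAt ℝ ∞ f x := fun x hx =>
    (contDiffAt_norm ℝ hx).smul (hs.contDiffAt_radialExt hx)
  have hsk : ∀ x : E3, x ≠ 0 → IsSkew (fderiv ℝ f x) := by
    intro x hx
    obtain ⟨m, hm⟩ := exists_eq_norm_smul hx
    rw [hm, (hasFDerivAt_norm_smul_radialExt hs (norm_pos_iff.mpr hx) m).fderiv]
    exact hk.isSkew hs ht m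
  have hrank : 1 < Module.rank ℝ E3 := by
    rw [← Module.finrank_eq_rank, finrank_euclideanSpace_fin]
    norm_num
  -- `ℝ³ ∖ {0}` is connected, so a derivative that is locally constant there is one fixed `A`.
  obtain ⟨A, hA⟩ := hopen.exists_is_const_of_fderiv_eq_zero (𝕜 := ℝ) (f := fderiv ℝ f)
    (isConnected_compl_singleton_of_one_lt_rank hrank (0 : E3)).isPreconnected
    (fun x hx => (differentiableAt_fderiv_of_smooth (hsm x hx)).differentiableWithinAt)
    (fun x hx => fderiv_fderiv_eq_zero_of_skew (hsm x hx)
      (Filter.mem_of_superset (hopen.mem_nhds hx) fun y hy => hsk y hy))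
  have hD : ∀ n : S2, A = dS Y n + (innerSL ℝ (n : E3)).smulRight (Y n) := fun n => by
    rw [← hA n (ne_zero_of_mem_unit_sphere n)]
    have := (hasFDerivAt_norm_smul_radialExt hs one_pos n).fderiv
    rwa [one_smul] at this
  refine ⟨A, ?_, fun n => ?_⟩
  · obtain ⟨x, hx⟩ := exists_ne (0 : E3)
    exact hA x hx ▸ hsk x hx
  · rw [hD n]
    simp [dS_self]

theorem isKilling_of_isSkew {A : E3 →L[ℝ] E3} (hA : IsSkew A) : IsKilling fun n => A n := by
  intro n u v hu hv
  simp only [covDeriv, ContinuousLinearMap.comp_apply]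
  rw [dS_restrict_apply A.differentiableAt hu, dS_restrict_apply A.differentiableAt hv, A.fderiv]
  rw [real_inner_comm _ u]
  simp only [tangentProj_apply, inner_sub_left, real_inner_smul_left, hv, hu, hA u v]
  rw [real_inner_comm (A v) u]
  ring

/-! ### Rotations commute with the divergence and the gradient -/

/-- The trace of endomorphisms of `ℝ³` as a continuous linear form. -/
noncomputable def traceL : (E3 →L[ℝ] E3) →L[ℝ] ℝ :=
  LinearMap.toContinuousLinearMap ((LinearMap.trace ℝ E3).comp (ContinuousLinearMap.coeLM ℝ))

theorem traceL_apply (A : E3 →L[ℝ] E3) : traceL A = LinearMap.trace ℝ E3 (A : E3 →ₗ[ℝ] E3) := rfl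

theorem traceL_comp_comm (A B : E3 →L[ℝ] E3) : traceL (A.comp B) = traceL (B.comp A) :=
  LinearMap.trace_mul_comm ℝ (A : E3 →ₗ[ℝ] E3) (B : E3 →ₗ[ℝ] E3)

/-- Cyclicity of the trace moves the projection to the argument, where `dS` already ignores the
normal direction. -/
theorem divS_eq (V : S2 → E3) (n : S2) : divS V n = traceL (dS V n) := by
  rw [divS, ← traceL_apply, covDeriv, traceL_comp_comm]
  congr 1
  ext1 u
  simp [tangentProj_apply, dS_self]

theorem SmoothS2.contDiffAt_fderiv_radialExt {V : Type} [NormedAddCommGroup V] [NormedSpace ℝ V]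
    {g : S2 → V} (hg : SmoothS2 g) (n : S2) : ContDiffAt ℝ ∞ (fderiv ℝ (radialExt g)) n :=
  (hg.contDiffAt_radialExt (ne_zero_of_mem_unit_sphere n)).fderiv_right (by simp)

theorem SmoothS2.divS {K : S2 → E3} (hK : SmoothS2 K) : SmoothS2 (divS K) := by
  rw [show DustSymmetry.divS K = fun n : S2 => traceL (fderiv ℝ (radialExt K) n) from
    funext (divS_eq K)]
  exact smoothS2_restrict (G := fun x => traceL (fderiv ℝ (radialExt K) x)) fun n =>
    traceL.contDiff.contDiffAt.comp _ (hK.contDiffAt_fderiv_radialExt n)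

theorem SmoothS2.gradS {W : S2 → ℝ} (hW : SmoothS2 W) : SmoothS2 (gradS W) :=
  smoothS2_restrict (G := gradient (radialExt W)) fun n =>
    (InnerProductSpace.toDual ℝ E3).symm.contDiff.contDiffAt.comp _
      (hW.contDiffAt_fderiv_radialExt n)

theorem SmoothS2.dS_apply {V : Type} [NormedAddCommGroup V] [NormedSpace ℝ V]
    {g : S2 → V} (hg : SmoothS2 g) (A : E3 →L[ℝ] E3) : SmoothS2 fun n => dS g n (A n) :=
  smoothS2_restrict (G := fun x => fderiv ℝ (radialExt g) x (A x)) fun n =>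
    (hg.contDiffAt_fderiv_radialExt n).clm_apply A.contDiff.contDiffAt

/-- The derivative has degree -1 and `A x` has degree 1, so their pairing is constant along rays. -/
theorem radialExt_dS_apply {V : Type} [NormedAddCommGroup V] [NormedSpace ℝ V]
    (g : S2 → V) (A : E3 →L[ℝ] E3) :
    radialExt (fun n => dS g n (A n)) = fun x => fderiv ℝ (radialExt g) x (A x) := by
  refine (eq_radialExt (by simp) fun r n hr => ?_).symm
  rw [fderiv_radialExt_smul g hr, map_smul, smul_apply, map_smul, inv_smul_smul₀ hr.ne', dS]

theorem SmoothS2.hasFDerivAt_radialExt_dS_apply {V : Type} [NormedAddCommGroup V]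
    [NormedSpace ℝ V] {g : S2 → V} (hg : SmoothS2 g) (A : E3 →L[ℝ] E3) (n : S2) :
    HasFDerivAt (radialExt fun n => dS g n (A n))
      (fderiv ℝ (fderiv ℝ (radialExt g)) n (A n) + (dS g n).comp A) n := by
  have hg' := hg.contDiffAt_radialExt (ne_zero_of_mem_unit_sphere n)
  rw [radialExt_dS_apply]
  refine ((differentiableAt_fderiv_of_smooth hg').hasFDerivAt.clm_apply
    A.hasFDerivAt).congr_fderiv ?_
  ext1 u
  simp [fderiv_fderiv_comm_of_smooth hg' u, dS, add_comm]

/-- The derivative along a rotation of a map on the sphere, computed from an extension that is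
homogeneous of degree `-1`. -/
theorem dS_apply_of_homogeneous {V : Type} [NormedAddCommGroup V] [NormedSpace ℝ V] {g : S2 → V}
    {G : E3 → V} {n : S2} (hG : DifferentiableAt ℝ G n)
    (h : ∀ (r : ℝ) (m : S2), 0 < r → r • G (r • (m : E3)) = g m) {u : E3}
    (hu : ⟪(n : E3), u⟫ = 0) : dS g n u = fderiv ℝ G n u := by
  -- Multiplying by `‖x‖` restores degree 0, and the derivative of the norm vanishes on the tangent
  -- vector `u`.
  have h1 : (fun x => ‖x‖ • G x) = radialExt g := by
    refine eq_radialExt (by simp) fun r m hr => ?_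
    rw [norm_smul, Real.norm_of_nonneg hr.le, norm_eq_of_mem_sphere, mul_one, h r m hr]
  have h2 := hasFDerivAt_norm_smul_coe one_pos n
  rw [one_smul] at h2
  have h3 : HasFDerivAt (fun x => ‖x‖ • G x) _ (n : E3) := h2.smul hG.hasFDerivAt
  rw [dS, ← h1, h3.fderiv]
  simp [hu]

/-- The derivative of `L_A K` is `D²K(A n) + DK ∘ A - A ∘ DK`. The commutator has trace zero, and
the trace of `D²K(A n)` is the derivative of `div K` along `A n`. -/
theorem divS_rotation {A : E3 →L[ℝ] E3} (hA : IsSkew A) {K : S2 → E3} (hK : SmoothS2 K) (n : S2) :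
    divS (fun m => dS K m (A m) - A (K m)) n = dS (divS K) n (A n) := by
  have hK' := hK.contDiffAt_radialExt (ne_zero_of_mem_unit_sphere n)
  have hD := differentiableAt_fderiv_of_smooth hK'
  have h1 : dS (fun m => dS K m (A m) - A (K m)) n =
      fderiv ℝ (fderiv ℝ (radialExt K)) n (A n) + (dS K n).comp A - A.comp (dS K n) := by
    have e : radialExt (fun m => dS K m (A m) - A (K m)) =
        fun x => radialExt (fun m => dS K m (A m)) x - A (radialExt K x) := by
      refine (eq_radialExt (by simp [radialExt]) fun r m hr => ?_).symm
      rw [radialExt_smul _ hr, radialExt_smul _ hr, radialExt_coe, radialExt_coe]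
    rw [dS, e]
    exact ((hK.hasFDerivAt_radialExt_dS_apply A n).sub
      (A.hasFDerivAt.comp _ (hK.differentiableAt_radialExt n).hasFDerivAt)).fderiv
  have h2 : HasFDerivAt (fun x => traceL (fderiv ℝ (radialExt K) x))
      (traceL.comp (fderiv ℝ (fderiv ℝ (radialExt K)) n)) n :=
    traceL.hasFDerivAt.comp _ hD.hasFDerivAt
  rw [divS_eq, h1, map_sub, map_add, traceL_comp_comm A, add_sub_cancel_right,
    dS_apply_of_homogeneous h2.differentiableAt _ (hA.inner_self _), h2.fderiv]
  · rfl
  · intro r m hr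
    rw [fderiv_radialExt_smul _ hr, map_smul, smul_inv_smul₀ hr.ne', divS_eq, dS]

/-- Differentiating `dW(A x)` gives `D²W(A n) + dW ∘ A`; skewness of `A` turns the second term into
`-A (grad W)`. -/
theorem gradS_rotation {A : E3 →L[ℝ] E3} (hA : IsSkew A) {W : S2 → ℝ} (hW : SmoothS2 W) (n : S2) :
    gradS (fun m => dS W m (A m)) n = dS (gradS W) n (A n) - A (gradS W n) := by
  have hW' := hW.contDiffAt_radialExt (ne_zero_of_mem_unit_sphere n)
  have hD := differentiableAt_fderiv_of_smooth hW'
  have h2 : HasFDerivAt (gradient (radialExt W)) _ (n : E3) :=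
    (InnerProductSpace.toDual ℝ E3).symm.toContinuousLinearEquiv.hasFDerivAt.comp _ hD.hasFDerivAt
  have h3 : ∀ u, ⟪gradS W n, u⟫ = dS W n u := fun u =>
    InnerProductSpace.toDual_symm_apply
  rw [dS_apply_of_homogeneous h2.differentiableAt _ (hA.inner_self _), h2.fderiv]
  · refine ext_inner_right ℝ fun u => ?_
    rw [inner_sub_left, hA, h3, sub_neg_eq_add, gradS, gradient,
      InnerProductSpace.toDual_symm_apply, (hW.hasFDerivAt_radialExt_dS_apply A n).fderiv]
    simp
  · intro r m hr
    rw [gradient, fderiv_radialExt_smul _ hr, map_smul, smul_inv_smul₀ hr.ne', gradS, gradient]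

/-! ### Expansions at infinity -/

/-- The fields `ξ`, `ξ^r`, `ξ^A` are given by smooth functions of `(1/r, x/r)` for `r > R`. -/
structure HasExpansion (a : SmearingField) (F P : ℝ × E3 → ℝ) (Q : ℝ × E3 → E3) (R : ℝ) :
    Prop where
  smooth_F : ContDiff ℝ ∞ F
  smooth_P : ContDiff ℝ ∞ P
  smooth_Q : ContDiff ℝ ∞ Q
  pos : 0 < R
  time : ∀ (r : ℝ) (n : S2), R < r → a.1 (r • (n : E3)) = F (r⁻¹, n)
  space : ∀ (r : ℝ) (n : S2), R < r →
    a.2 (r • (n : E3)) = P (r⁻¹, n) • (n : E3) + r • Q (r⁻¹, n)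
  tangent : ∀ (r : ℝ) (n : S2), R < r → ⟪(n : E3), Q (r⁻¹, n)⟫ = 0

/-- The boundary data read off from the expansion functions at `1/r = 0`. -/
structure HasLimit (F P : ℝ × E3 → ℝ) (Q : ℝ × E3 → E3) (d : BoundaryData) : Prop where
  f : ∀ n : S2, F (0, n) = d.f n
  W : ∀ n : S2, P (0, n) = d.W n
  Y : ∀ n : S2, Q (0, n) = d.Y n
  I : ∀ n : S2, HasDerivAt (fun s : ℝ => Q (s, n)) (d.I n) 0

theorem hasBoundaryData_iff {a : SmearingField} {d : BoundaryData} :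
    SmearingField.HasBoundaryData a d ↔
      ∃ F P Q R, HasExpansion a F P Q R ∧ HasLimit F P Q d := by
  constructor
  · rintro ⟨F, P, Q, R, hF, hP, hQ, hR, h, h'⟩
    exact ⟨F, P, Q, R, ⟨hF, hP, hQ, hR, fun r n hr => (h r n hr).1, fun r n hr => (h r n hr).2.1,
      fun r n hr => (h r n hr).2.2⟩, ⟨fun n => (h' n).1, fun n => (h' n).2.1,
      fun n => (h' n).2.2.1, fun n => (h' n).2.2.2⟩⟩
  · rintro ⟨F, P, Q, R, h, h'⟩
    exact ⟨F, P, Q, R, h.smooth_F, h.smooth_P, h.smooth_Q, h.pos,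
      fun r n hr => ⟨h.time r n hr, h.space r n hr, h.tangent r n hr⟩,
      fun n => ⟨h'.f n, h'.W n, h'.Y n, h'.I n⟩⟩

theorem eventually_exists_smul {R r : ℝ} (hR : 0 < R) (hr : R < r) (n : S2) :
    ∀ᶠ x in nhds (r • (n : E3)), ∃ (t : ℝ) (m : S2), R < t ∧ x = t • (m : E3) := by
  have h : R < ‖r • (n : E3)‖ := by simpa [norm_smul, abs_of_pos (hR.trans hr)] using hr
  filter_upwards [continuous_norm.continuousAt.eventually_const_lt h] with x hx
  obtain ⟨m, hm⟩ := exists_eq_norm_smul (norm_pos_iff.mp (hR.trans hx))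
  exact ⟨‖x‖, m, hx, hm⟩

/-- The derivative of a function of `(1/r, x/r)` along `ξ⃗ = P n + r Q`. -/
noncomputable def transport {V : Type} [NormedAddCommGroup V] [NormedSpace ℝ V]
    (P : ℝ × E3 → ℝ) (Q : ℝ × E3 → E3) (G : ℝ × E3 → V) (z : ℝ × E3) : V :=
  fderiv ℝ G z (-(z.1 ^ 2 * P z), Q z)

/-- The coefficients `-s² P` and `Q` are smooth through `s = 0`; this is what makes the class of
expansions in `1/r` stable under the bracket. -/
theorem contDiff_transport {V : Type} [NormedAddCommGroup V] [NormedSpace ℝ V]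
    {P : ℝ × E3 → ℝ} {Q : ℝ × E3 → E3} {G : ℝ × E3 → V} (hP : ContDiff ℝ ∞ P)
    (hQ : ContDiff ℝ ∞ Q) (hG : ContDiff ℝ ∞ G) : ContDiff ℝ ∞ (transport P Q G) :=
  (hG.fderiv_right (m := ∞) (by simp)).clm_apply
    ((((contDiff_fst.pow 2).mul hP).neg).prodMk hQ)

section Expansion

variable {a b : SmearingField} {F P F' P' : ℝ × E3 → ℝ} {Q Q' : ℝ × E3 → E3} {R R' : ℝ}

theorem HasExpansion.mono (h : HasExpansion a F P Q R) (hR : R ≤ R') : HasExpansion a F P Q R' :=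
  ⟨h.smooth_F, h.smooth_P, h.smooth_Q, h.pos.trans_le hR, fun r n hr => h.time r n (hR.trans_lt hr),
    fun r n hr => h.space r n (hR.trans_lt hr), fun r n hr => h.tangent r n (hR.trans_lt hr)⟩

theorem HasExpansion.fderiv_time (h : HasExpansion a F P Q R) {r : ℝ} (hr : R < r) {n : S2}
    (p : ℝ) {q : E3} (hq : ⟪(n : E3), q⟫ = 0) :
    fderiv ℝ a.1 (r • (n : E3)) (p • (n : E3) + r • q) =
      fderiv ℝ F (r⁻¹, (n : E3)) (-(r⁻¹ ^ 2 * p), q) := by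
  have e : a.1 =ᶠ[nhds (r • (n : E3))] fun x => F (polar x) := by
    filter_upwards [eventually_exists_smul h.pos hr n]
    rintro _ ⟨t, m, ht, rfl⟩
    rw [h.time t m ht, polar_smul (h.pos.trans ht)]
  rw [e.fderiv_eq, fderiv_comp_polar (h.pos.trans hr)
    (h.smooth_F.differentiable (by simp)).differentiableAt p hq]

/-- Product rule for `P n + r Q`. The last bracket comes from differentiating `n` and `r`
themselves; it is symmetric under exchange of the two fields and drops out of the commutator. -/
theorem HasExpansion.fderiv_space (h : HasExpansion a F P Q R) {r : ℝ} (hr : R < r) {n : S2}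
    (p : ℝ) {q : E3} (hq : ⟪(n : E3), q⟫ = 0) :
    fderiv ℝ a.2 (r • (n : E3)) (p • (n : E3) + r • q) =
      fderiv ℝ P (r⁻¹, (n : E3)) (-(r⁻¹ ^ 2 * p), q) • (n : E3) +
        r • fderiv ℝ Q (r⁻¹, (n : E3)) (-(r⁻¹ ^ 2 * p), q) +
        (P (r⁻¹, n) • q + p • Q (r⁻¹, n)) := by
  have h0 := h.pos.trans hr
  have hP := (h.smooth_P.differentiable (by simp)).differentiableAt (x := (r⁻¹, (n : E3)))
  have hQ := (h.smooth_Q.differentiable (by simp)).differentiableAt (x := (r⁻¹, (n : E3)))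
  have e : a.2 =ᶠ[nhds (r • (n : E3))] fun x =>
      P (polar x) • (polar x).2 + ‖x‖ • Q (polar x) := by
    filter_upwards [eventually_exists_smul h.pos hr n]
    rintro _ ⟨t, m, ht, rfl⟩
    have ht0 := h.pos.trans ht
    rw [h.space t m ht, polar_smul ht0, norm_smul, Real.norm_of_nonneg ht0.le,
      norm_eq_of_mem_sphere, mul_one]
  have hpol := (hasFDerivAt_polar h0 n).differentiableAt
  have hP' : DifferentiableAt ℝ (fun x => P (polar x)) (r • (n : E3)) :=
    (polar_smul h0 n ▸ hP : DifferentiableAt ℝ P _).comp _ hpol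
  have hQ' : DifferentiableAt ℝ (fun x => Q (polar x)) (r • (n : E3)) :=
    (polar_smul h0 n ▸ hQ : DifferentiableAt ℝ Q _).comp _ hpol
  have hD : HasFDerivAt (fun x => P (polar x) • (polar x).2 + ‖x‖ • Q (polar x)) _
      (r • (n : E3)) := (hP'.hasFDerivAt.smul (hasFDerivAt_polar h0 n).snd).add
    ((hasFDerivAt_norm_smul_coe h0 n).smul hQ'.hasFDerivAt)
  have hp : ⟪(n : E3), p • (n : E3) + r • q⟫ = p := by
    rw [inner_add_right, real_inner_smul_right, real_inner_smul_right, hq, inner_coe_self]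
    ring
  have ht : r⁻¹ • tangentProj n (p • (n : E3) + r • q) = q := by
    rw [tangentProj_apply, hp, add_sub_cancel_left, inv_smul_smul₀ h0.ne']
  rw [e.fderiv_eq, hD.fderiv]
  simp only [add_apply, smul_apply, ContinuousLinearMap.smulRight_apply, innerSL_apply_apply, hp,
    fderiv_comp_polar h0 hP p hq, fderiv_comp_polar h0 hQ p hq, polar_smul h0,
    ContinuousLinearMap.comp_apply, ContinuousLinearMap.prod_apply,
    ContinuousLinearMap.coe_snd', ht, norm_smul, Real.norm_of_nonneg h0.le,
    norm_eq_of_mem_sphere, mul_one]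
  abel

/-- Obtained by differentiating tangency. The right side is symmetric in the two angular parts, so
the angular part of a commutator is again tangent. -/
theorem HasExpansion.inner_transport (h : HasExpansion a F P Q R) {r : ℝ} (hr : R < r) {n : S2}
    (p : ℝ) {q : E3} (hq : ⟪(n : E3), q⟫ = 0) :
    ⟪(n : E3), fderiv ℝ Q (r⁻¹, (n : E3)) (-(r⁻¹ ^ 2 * p), q)⟫ = -⟪q, Q (r⁻¹, n)⟫ := by
  have h0 := h.pos.trans hr
  have hQ := (h.smooth_Q.differentiable (by simp)).differentiableAt (x := (r⁻¹, (n : E3)))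
  have hG : HasFDerivAt (fun z : ℝ × E3 => ⟪z.2, Q z⟫) _ (r⁻¹, (n : E3)) :=
    hasFDerivAt_snd.inner ℝ hQ.hasFDerivAt
  -- Tangency of `Q` is known only at points `(1/r, n)` with `n` on the sphere, hence the
  -- composition with `polar`.
  have e : (fun x => ⟪(polar x).2, Q (polar x)⟫) =ᶠ[nhds (r • (n : E3))] fun _ => 0 := by
    filter_upwards [eventually_exists_smul h.pos hr n]
    rintro _ ⟨t, m, ht, rfl⟩
    rw [polar_smul (h.pos.trans ht), h.tangent t m ht]
  have h1 := fderiv_comp_polar h0 hG.differentiableAt p hq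
  rw [e.fderiv_eq, hG.fderiv] at h1
  simp at h1
  rw [← inv_pow] at h1
  linarith

theorem HasExpansion.bracket (h : HasExpansion a F P Q R) (h' : HasExpansion b F' P' Q' R) :
    HasExpansion (SmearingField.bracket a b)
      (fun z => transport P Q F' z - transport P' Q' F z)
      (fun z => transport P Q P' z - transport P' Q' P z)
      (fun z => transport P Q Q' z - transport P' Q' Q z) R where
  smooth_F := (contDiff_transport h.smooth_P h.smooth_Q h'.smooth_F).sub
    (contDiff_transport h'.smooth_P h'.smooth_Q h.smooth_F)
  smooth_P := (contDiff_transport h.smooth_P h.smooth_Q h'.smooth_P).sub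
    (contDiff_transport h'.smooth_P h'.smooth_Q h.smooth_P)
  smooth_Q := (contDiff_transport h.smooth_P h.smooth_Q h'.smooth_Q).sub
    (contDiff_transport h'.smooth_P h'.smooth_Q h.smooth_Q)
  pos := h.pos
  time := fun r n hr => by
    simp only [SmearingField.bracket, h.space r n hr, h'.space r n hr]
    rw [h.fderiv_time hr _ (h'.tangent r n hr), h'.fderiv_time hr _ (h.tangent r n hr)]
    rfl
  space := fun r n hr => by
    simp only [SmearingField.bracket, VectorField.lieBracket, h.space r n hr, h'.space r n hr]
    rw [h.fderiv_space hr _ (h'.tangent r n hr), h'.fderiv_space hr _ (h.tangent r n hr)]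
    simp only [transport, sub_smul, smul_sub]
    abel
  tangent := fun r n hr => by
    simp only [transport, inner_sub_right]
    rw [h.inner_transport hr _ (h'.tangent r n hr), h'.inner_transport hr _ (h.tangent r n hr),
      real_inner_comm]
    ring

/-! ### The boundary data are determined by the field -/

/-- Continuity fixes the value and uniqueness of the one-sided derivative fixes the slope. This
serves both the uniqueness of the boundary data and the tangency of `Y` and `I`, as the fields
control `Q` only for `s > 0`. -/
theorem eq_zero_of_eqOn_Ioo {V : Type} [NormedAddCommGroup V] [NormedSpace ℝ V] {h : ℝ → V}
    {h' : V} {ε : ℝ} (hε : 0 < ε) (hd : HasDerivAt h h' 0) (h0 : ∀ s, 0 < s → s < ε → h s = 0) :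
    h 0 = 0 ∧ h' = 0 := by
  have hev : h =ᶠ[nhdsWithin 0 (Set.Ioi 0)] fun _ => 0 := by
    filter_upwards [Ioo_mem_nhdsGT hε] with s hs using h0 s hs.1 hs.2
  have h1 : h 0 = 0 := tendsto_nhds_unique
    (hd.continuousAt.tendsto.mono_left nhdsWithin_le_nhds) (tendsto_const_nhds.congr' hev.symm)
  refine ⟨h1, ?_⟩
  have h2 : HasDerivWithinAt h 0 (Set.Ioi 0) 0 :=
    (hasDerivWithinAt_const 0 _ (0 : V)).congr_of_eventuallyEq hev h1
  exact (uniqueDiffWithinAt_Ioi (0 : ℝ)).eq_deriv _ hd.hasDerivWithinAt h2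

theorem hasDerivAt_prodMk_const {V : Type} [NormedAddCommGroup V] [NormedSpace ℝ V]
    {G : ℝ × E3 → V} (hG : ContDiff ℝ ∞ G) (x : E3) (s : ℝ) :
    HasDerivAt (fun s => G (s, x)) (fderiv ℝ G (s, x) (1, 0)) s :=
  ((hG.differentiable (by simp)).differentiableAt.hasFDerivAt).comp_hasDerivAt s
    ((hasDerivAt_id s).prodMk (hasDerivAt_const s x))

theorem inv_lt_of_lt_inv {s : ℝ} (hs : 0 < s) (h : s < R⁻¹) (hR : 0 < R) : R < s⁻¹ :=
  (lt_inv_comm₀ hR hs).2 h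

/-- Pairing with `n` isolates `ξ^r`, since `Q` is tangent; what remains determines `ξ^A`. -/
theorem HasExpansion.eq_near (h : HasExpansion a F P Q R) (h' : HasExpansion a F' P' Q' R)
    {s : ℝ} (hs : 0 < s) (hs' : s < R⁻¹) (n : S2) :
    F (s, n) = F' (s, n) ∧ P (s, n) = P' (s, n) ∧ Q (s, n) = Q' (s, n) := by
  have hr := inv_lt_of_lt_inv hs hs' h.pos
  have h1 := (h.time _ n hr).symm.trans (h'.time _ n hr)
  have h2 := (h.space _ n hr).symm.trans (h'.space _ n hr)
  have t1 := h.tangent _ n hr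
  have t2 := h'.tangent _ n hr
  rw [inv_inv] at h1 h2 t1 t2
  have h3 := congrArg (fun v => ⟪(n : E3), v⟫) h2
  simp only [inner_add_right, real_inner_smul_right, inner_coe_self, t1, t2, mul_one, mul_zero,
    add_zero] at h3
  rw [h3] at h2
  exact ⟨h1, h3, smul_right_injective E3 (inv_ne_zero hs.ne') (add_left_cancel h2)⟩

theorem HasLimit.unique {d e : BoundaryData} (h : HasExpansion a F P Q R)
    (h' : HasExpansion a F' P' Q' R) (hd : HasLimit F P Q d) (he : HasLimit F' P' Q' e) :
    d = e := by
  have hR := inv_pos.mpr h.pos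
  have k1 : ∀ n : S2, d.f n = e.f n := fun n => by
    rw [← hd.f, ← he.f]
    exact sub_eq_zero.1 (eq_zero_of_eqOn_Ioo hR ((hasDerivAt_prodMk_const h.smooth_F n 0).sub
      (hasDerivAt_prodMk_const h'.smooth_F n 0))
      fun s hs hs' => sub_eq_zero.2 (h.eq_near h' hs hs' n).1).1
  have k2 : ∀ n : S2, d.W n = e.W n := fun n => by
    rw [← hd.W, ← he.W]
    exact sub_eq_zero.1 (eq_zero_of_eqOn_Ioo hR ((hasDerivAt_prodMk_const h.smooth_P n 0).sub
      (hasDerivAt_prodMk_const h'.smooth_P n 0))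
      fun s hs hs' => sub_eq_zero.2 (h.eq_near h' hs hs' n).2.1).1
  have k3 : ∀ n : S2, d.Y n = e.Y n ∧ d.I n = e.I n := fun n => by
    rw [← hd.Y, ← he.Y]
    have := eq_zero_of_eqOn_Ioo hR ((hd.I n).sub (he.I n))
      fun s hs hs' => sub_eq_zero.2 (h.eq_near h' hs hs' n).2.2
    exact ⟨sub_eq_zero.1 this.1, sub_eq_zero.1 this.2⟩
  exact Prod.ext (funext k1) (Prod.ext (funext k2)
    (Prod.ext (funext fun n => (k3 n).1) (funext fun n => (k3 n).2)))

theorem HasBoundaryData.unique {d e : BoundaryData} (hd : SmearingField.HasBoundaryData a d)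
    (he : SmearingField.HasBoundaryData a e) : d = e := by
  obtain ⟨F, P, Q, R, h, hl⟩ := hasBoundaryData_iff.1 hd
  obtain ⟨F', P', Q', R', h', hm⟩ := hasBoundaryData_iff.1 he
  exact HasLimit.unique (h.mono (le_max_left R R')) (h'.mono (le_max_right R R')) hl hm

/-! ### Regularity of the boundary data -/

theorem HasLimit.Y_I_tangent {d : BoundaryData} (h : HasExpansion a F P Q R)
    (hd : HasLimit F P Q d) : IsTangent d.Y ∧ IsTangent d.I := by
  have key : ∀ n : S2, ⟪(n : E3), d.Y n⟫ = 0 ∧ ⟪(n : E3), d.I n⟫ = 0 := fun n => by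
    have hder : HasDerivAt (fun s => ⟪(n : E3), Q (s, n)⟫) ⟪(n : E3), d.I n⟫ 0 := by
      simpa using (hasDerivAt_const (0 : ℝ) (n : E3)).inner ℝ (hd.I n)
    have := eq_zero_of_eqOn_Ioo (inv_pos.mpr h.pos) hder fun s hs hs' => by
      have := h.tangent s⁻¹ n (inv_lt_of_lt_inv hs hs' h.pos)
      rwa [inv_inv] at this
    rwa [hd.Y] at this
  exact ⟨fun n => (key n).1, fun n => (key n).2⟩

theorem contDiff_zero_prodMk {V : Type} [NormedAddCommGroup V] [NormedSpace ℝ V]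
    {G : ℝ × E3 → V} (hG : ContDiff ℝ ∞ G) : ContDiff ℝ ∞ fun x : E3 => G (0, x) :=
  hG.comp (contDiff_const.prodMk contDiff_id)

theorem fderiv_zero_prodMk {V : Type} [NormedAddCommGroup V] [NormedSpace ℝ V]
    {G : ℝ × E3 → V} (hG : ContDiff ℝ ∞ G) (x u : E3) :
    fderiv ℝ (fun x : E3 => G (0, x)) x u = fderiv ℝ G (0, x) (0, u) := by
  have h : HasFDerivAt (fun x : E3 => G (0, x)) _ x :=
    ((hG.differentiable (by simp)).differentiableAt.hasFDerivAt).comp x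
      ((hasFDerivAt_const (0 : ℝ) x).prodMk (hasFDerivAt_id x))
  rw [h.fderiv]
  simp

theorem contDiff_fderiv_zero_prodMk {V : Type} [NormedAddCommGroup V] [NormedSpace ℝ V]
    {G : ℝ × E3 → V} (hG : ContDiff ℝ ∞ G) :
    ContDiff ℝ ∞ fun z : ℝ × E3 => fderiv ℝ G z (1, 0) :=
  (hG.fderiv_right (m := ∞) (by simp)).clm_apply contDiff_const

section Limit

variable {d e : BoundaryData}

theorem HasLimit.f_eq (hd : HasLimit F P Q d) : d.f = fun n : S2 => F (0, n) :=
  funext fun n => (hd.f n).symm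

theorem HasLimit.W_eq (hd : HasLimit F P Q d) : d.W = fun n : S2 => P (0, n) :=
  funext fun n => (hd.W n).symm

theorem HasLimit.Y_eq (hd : HasLimit F P Q d) : d.Y = fun n : S2 => Q (0, n) :=
  funext fun n => (hd.Y n).symm

theorem HasLimit.I_eq (hQ : ContDiff ℝ ∞ Q) (hd : HasLimit F P Q d) :
    d.I = fun n : S2 => fderiv ℝ Q (0, (n : E3)) (1, 0) :=
  funext fun n => (hd.I n).unique (hasDerivAt_prodMk_const hQ n 0)

theorem smoothS2_zero_prodMk {V : Type} [NormedAddCommGroup V] [NormedSpace ℝ V]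
    {G : ℝ × E3 → V} (hG : ContDiff ℝ ∞ G) : SmoothS2 fun n : S2 => G (0, n) :=
  smoothS2_restrict (G := fun x : E3 => G (0, x)) fun _ => (contDiff_zero_prodMk hG).contDiffAt

theorem dS_zero_prodMk {V : Type} [NormedAddCommGroup V] [NormedSpace ℝ V]
    {G : ℝ × E3 → V} (hG : ContDiff ℝ ∞ G) {n : S2} {u : E3} (hu : ⟪(n : E3), u⟫ = 0) :
    dS (fun m : S2 => G (0, m)) n u = fderiv ℝ G (0, (n : E3)) (0, u) := by
  rw [dS_restrict_apply (G := fun x : E3 => G (0, x))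
    ((contDiff_zero_prodMk hG).differentiable (by simp)).differentiableAt hu, fderiv_zero_prodMk hG]

theorem HasLimit.isAdmissible (h : HasExpansion a F P Q R) (hd : HasLimit F P Q d)
    (hk : IsKilling d.Y) : d.IsAdmissible where
  smooth_f := hd.f_eq ▸ smoothS2_zero_prodMk h.smooth_F
  smooth_W := hd.W_eq ▸ smoothS2_zero_prodMk h.smooth_P
  smooth_Y := hd.Y_eq ▸ smoothS2_zero_prodMk h.smooth_Q
  smooth_I := hd.I_eq h.smooth_Q ▸ smoothS2_zero_prodMk (contDiff_fderiv_zero_prodMk h.smooth_Q)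
  tangent_Y := (hd.Y_I_tangent h).1
  tangent_I := (hd.Y_I_tangent h).2
  killing_Y := hk

end Limit

end Expansion

/-! ### The bracket of boundary data -/

section Bracket

variable {d e : BoundaryData}

/-- The two normal components are both `-⟪Y₁, Y₂⟫` and cancel, so the tangential projection in
`covDeriv` may be dropped. -/
theorem BoundaryData.bracket_Y (hd : d.IsAdmissible) (he : e.IsAdmissible) (n : S2) :
    (d.bracket e).Y n = dS e.Y n (d.Y n) - dS d.Y n (e.Y n) := by
  change covDeriv e.Y n (d.Y n) - covDeriv d.Y n (e.Y n) = _
  rw [covDeriv, covDeriv, ContinuousLinearMap.comp_apply, ContinuousLinearMap.comp_apply, ← map_sub]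
  refine tangentProj_of_inner_eq_zero ?_
  rw [inner_sub_right, inner_dS_of_isTangent he.smooth_Y he.tangent_Y,
    inner_dS_of_isTangent hd.smooth_Y hd.tangent_Y, real_inner_comm]
  ring

theorem BoundaryData.bracket_I (hd : d.IsAdmissible) (he : e.IsAdmissible) (n : S2) :
    (d.bracket e).I n = dS e.I n (d.Y n) + dS e.Y n (d.I n)
      - (dS d.I n (e.Y n) + dS d.Y n (e.I n)) := by
  change covDeriv e.I n (d.Y n) + covDeriv e.Y n (d.I n)
    - (covDeriv d.I n (e.Y n) + covDeriv d.Y n (e.I n)) = _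
  simp only [covDeriv, ContinuousLinearMap.comp_apply]
  rw [← map_add, ← map_add, ← map_sub]
  refine tangentProj_of_inner_eq_zero ?_
  rw [inner_sub_right, inner_add_right, inner_add_right,
    inner_dS_of_isTangent he.smooth_Y he.tangent_Y, inner_dS_of_isTangent hd.smooth_Y hd.tangent_Y,
    inner_dS_of_isTangent he.smooth_I he.tangent_I, inner_dS_of_isTangent hd.smooth_I hd.tangent_I,
    real_inner_comm (e.I n), real_inner_comm (e.Y n)]
  ring

theorem dS_of_linear {Y : S2 → E3} {A : E3 →L[ℝ] E3} (hA : ∀ n : S2, Y n = A n) {n : S2} {u : E3}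
    (hu : ⟪(n : E3), u⟫ = 0) : dS Y n u = A u := by
  rw [funext hA, dS_restrict_apply A.differentiableAt hu, A.fderiv]

/-- For rotations `A` and `B` the bracket is the linear field of the commutator `BA - AB`, which is
again skew. -/
theorem BoundaryData.bracket_isKilling (hd : d.IsAdmissible) (he : e.IsAdmissible) :
    IsKilling (d.bracket e).Y := by
  obtain ⟨A, hA, hA'⟩ := hd.killing_Y.exists_isSkew hd.smooth_Y hd.tangent_Y
  obtain ⟨B, hB, hB'⟩ := he.killing_Y.exists_isSkew he.smooth_Y he.tangent_Y
  have h : (d.bracket e).Y = fun n : S2 => (B.comp A - A.comp B) n := by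
    funext n
    rw [BoundaryData.bracket_Y hd he, dS_of_linear hB' (hd.tangent_Y n),
      dS_of_linear hA' (he.tangent_Y n), hA', hB']
    rfl
  rw [h]
  refine isKilling_of_isSkew fun u v => ?_
  simp only [sub_apply, ContinuousLinearMap.comp_apply, inner_sub_left, inner_sub_right,
    hA _ v, hB _ v, hA u, hB u]
  ring

variable {a b : SmearingField} {F P F' P' : ℝ × E3 → ℝ} {Q Q' : ℝ × E3 → E3} {R : ℝ}

theorem transport_zero {V : Type} [NormedAddCommGroup V] [NormedSpace ℝ V]
    {G : ℝ × E3 → V} (hG : ContDiff ℝ ∞ G) {n : S2} (hn : ⟪(n : E3), Q (0, n)⟫ = 0) :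
    transport P Q G (0, n) = dS (fun m : S2 => G (0, m)) n (Q (0, n)) := by
  rw [dS_zero_prodMk hG hn, transport]
  simp

/-- The radial coefficient `s² P` vanishes to second order at `s = 0`, so `W` does not enter the
bracket of the `I`-parts. Symmetry of second derivatives exchanges `∂_s` with the derivative along
the sphere. -/
theorem hasDerivAt_transport_zero (hP : ContDiff ℝ ∞ P) (hQ : ContDiff ℝ ∞ Q)
    (hQ' : ContDiff ℝ ∞ Q') {n : S2} (h0 : ⟪(n : E3), Q (0, n)⟫ = 0)
    (h1 : ⟪(n : E3), fderiv ℝ Q (0, (n : E3)) (1, 0)⟫ = 0) :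
    HasDerivAt (fun s => transport P Q Q' (s, n))
      (dS (fun m : S2 => fderiv ℝ Q' (0, (m : E3)) (1, 0)) n (Q (0, n)) +
        dS (fun m : S2 => Q' (0, m)) n (fderiv ℝ Q (0, (n : E3)) (1, 0))) 0 := by
  have hD : ContDiff ℝ ∞ (fderiv ℝ Q') := hQ'.fderiv_right (by simp)
  have k1 := hasDerivAt_prodMk_const hD n 0
  have k2 := (((hasDerivAt_id (0 : ℝ)).pow 2).mul (hasDerivAt_prodMk_const hP n 0)).neg.prodMk
    (hasDerivAt_prodMk_const hQ n 0)
  have k3 : HasDerivAt (fun s => transport P Q Q' (s, n)) _ 0 := k1.clm_apply k2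
  convert k3 using 1
  rw [dS_zero_prodMk hQ' h1,
    dS_zero_prodMk (G := fun z => fderiv ℝ Q' z (1, 0)) (contDiff_fderiv_zero_prodMk hQ') h0,
    fderiv_clm_apply_const (hD.differentiable (by simp)).differentiableAt,
    fderiv_fderiv_comm_of_smooth hQ'.contDiffAt]
  simp

theorem HasLimit.bracket (h : HasExpansion a F P Q R) (h' : HasExpansion b F' P' Q' R)
    (hl : HasLimit F P Q d) (hl' : HasLimit F' P' Q' e) (hd : d.IsAdmissible)
    (he : e.IsAdmissible) :
    HasLimit (fun z => transport P Q F' z - transport P' Q' F z)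
      (fun z => transport P Q P' z - transport P' Q' P z)
      (fun z => transport P Q Q' z - transport P' Q' Q z) (d.bracket e) where
  f := fun n => by
    rw [transport_zero h.smooth_F (by rw [hl'.Y, he.tangent_Y]),
      transport_zero h'.smooth_F (by rw [hl.Y, hd.tangent_Y]), hl.Y, hl'.Y, ← hl.f_eq, ← hl'.f_eq]
    rfl
  W := fun n => by
    rw [transport_zero h.smooth_P (by rw [hl'.Y, he.tangent_Y]),
      transport_zero h'.smooth_P (by rw [hl.Y, hd.tangent_Y]), hl.Y, hl'.Y, ← hl.W_eq, ← hl'.W_eq]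
    rfl
  Y := fun n => by
    rw [transport_zero h.smooth_Q (by rw [hl'.Y, he.tangent_Y]),
      transport_zero h'.smooth_Q (by rw [hl.Y, hd.tangent_Y]), hl.Y, hl'.Y, ← hl.Y_eq, ← hl'.Y_eq,
      BoundaryData.bracket_Y hd he]
  I := fun n => by
    have e1 := hl.I_eq h.smooth_Q
    have e2 := hl'.I_eq h'.smooth_Q
    have k1 := hasDerivAt_transport_zero h.smooth_P h.smooth_Q h'.smooth_Q (n := n)
      (by rw [hl.Y, hd.tangent_Y]) (by rw [← congrFun e1 n, hd.tangent_I])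
    have k2 := hasDerivAt_transport_zero h'.smooth_P h'.smooth_Q h.smooth_Q (n := n)
      (by rw [hl'.Y, he.tangent_Y]) (by rw [← congrFun e2 n, he.tangent_I])
    rw [← e2, ← hl'.Y_eq, ← congrFun e1 n, hl.Y] at k1
    rw [← e1, ← hl.Y_eq, ← congrFun e2 n, hl'.Y] at k2
    rw [BoundaryData.bracket_I hd he]
    exact k1.sub k2

theorem HasBoundaryData.bracket (ha : SmearingField.HasBoundaryData a d)
    (hb : SmearingField.HasBoundaryData b e) (hd : d.IsAdmissible) (he : e.IsAdmissible) :
    SmearingField.HasBoundaryData (a.bracket b) (d.bracket e) ∧ (d.bracket e).IsAdmissible := by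
  obtain ⟨F, P, Q, R, h, hl⟩ := hasBoundaryData_iff.1 ha
  obtain ⟨F', P', Q', R', h', hl'⟩ := hasBoundaryData_iff.1 hb
  have k := h.mono (le_max_left R R')
  have k' := h'.mono (le_max_right R R')
  have kl := HasLimit.bracket k k' hl hl' hd he
  exact ⟨hasBoundaryData_iff.2 ⟨_, _, _, _, k.bracket k', kl⟩,
    kl.isAdmissible (k.bracket k') (BoundaryData.bracket_isKilling hd he)⟩

theorem SmearingField.IsAdmissible.bracket (ha : a.IsAdmissible) (hb : b.IsAdmissible) :
    (a.bracket b).IsAdmissible := by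
  obtain ⟨ha1, ha2, d, hd, had⟩ := ha
  obtain ⟨hb1, hb2, e, he, hbe⟩ := hb
  have h := HasBoundaryData.bracket had hbe hd he
  exact ⟨((hb1.fderiv_right (m := ∞) (by simp)).clm_apply ha2).sub
    ((ha1.fderiv_right (m := ∞) (by simp)).clm_apply hb2),
    ha2.lieBracket_vectorField hb2 (by simp), _, h.2, h.1⟩

/-- All admissible boundary data are realized by smearing fields. -/
theorem BoundaryData.IsAdmissible.exists_hasBoundaryData (hd : d.IsAdmissible) :
    ∃ a : SmearingField, a.IsAdmissible ∧ SmearingField.HasBoundaryData a d := by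
  obtain ⟨A, hA, hA'⟩ := hd.killing_Y.exists_isSkew hd.smooth_Y hd.tangent_Y
  obtain ⟨F, hF, hF'⟩ := hd.smooth_f.exists_contDiff
  obtain ⟨P, hP, hP'⟩ := hd.smooth_W.exists_contDiff
  obtain ⟨J, hJ, hJ'⟩ := hd.smooth_I.exists_contDiff
  -- With `Q = A n + I/r` the field `W n + r Q` equals `W n + I + A x`. The first two terms have
  -- degree 0 and are cut off near the origin; `A x` is smooth everywhere.
  have hS : SmoothS2 fun n : S2 => d.W n • (n : E3) + d.I n :=
    ContMDiff.add (ContMDiff.smul hd.smooth_W contMDiff_coe_sphere) hd.smooth_I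
  obtain ⟨S, hS, hS'⟩ := hS.exists_contDiff
  have hF1 := fun n : S2 => hF' 1 n le_rfl
  have hP1 := fun n : S2 => hP' 1 n le_rfl
  have hJ1 := fun n : S2 => hJ' 1 n le_rfl
  simp only [one_smul] at hF1 hP1 hJ1
  have hbd : SmearingField.HasBoundaryData (F, fun x => S x + A x) d := by
    refine ⟨fun z => F z.2, fun z => P z.2, fun z => A z.2 + z.1 • J z.2, 1,
      hF.comp contDiff_snd, hP.comp contDiff_snd,
      (A.contDiff.comp contDiff_snd).add (contDiff_fst.smul (hJ.comp contDiff_snd)), one_pos,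
      fun r n hr => ⟨?_, ?_, ?_⟩, fun n => ⟨hF1 n, hP1 n, ?_, ?_⟩⟩
    · simp only [hF' r n hr.le, hF1]
    · simp only [hS' r n hr.le, hP1, hJ1, smul_add, map_smul,
        smul_inv_smul₀ (one_pos.trans hr).ne']
      abel
    · simp only [inner_add_right, real_inner_smul_right, hJ1, hd.tangent_I n, hA.inner_self]
      ring
    · simp [hA']
    · rw [← hJ1]
      simpa using ((hasDerivAt_id (0 : ℝ)).smul_const (J n)).const_add (A n)
  exact ⟨_, ⟨hF, hS.add A.contDiff, d, hd, hbd⟩, hbd⟩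

end Bracket

/-! ### Integrals over the sphere are invariant under rotations -/

section Integral

open MeasureTheory

/-- Integration in polar coordinates of a product of a radial and an angular function. -/
theorem integral_norm_mul_radialExt (φ : ℝ → ℝ) (h : S2 → ℝ) :
    ∫ x : E3, φ ‖x‖ * radialExt h x =
      integralS2 h * ∫ r : Set.Ioi (0 : ℝ), φ r ∂(Measure.volumeIoiPow (Module.finrank ℝ E3 - 1)) :=
  calc
    ∫ x : E3, φ ‖x‖ * radialExt h x =
        ∫ x : ({(0)}ᶜ : Set E3), φ ‖x.1‖ * radialExt h x.1 ∂((volume : Measure E3).comap Subtype.val) := by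
      rw [integral_subtype_comap (measurableSet_singleton _).compl
        fun x : E3 => φ ‖x‖ * radialExt h x, restrict_compl_singleton]
    _ = ∫ x, h x.1 * φ x.2 ∂(volume : Measure E3).toSphere.prod
          (.volumeIoiPow (Module.finrank ℝ E3 - 1)) := by
      refine Eq.trans (integral_congr_ae (Filter.Eventually.of_forall fun x => ?_))
        (volume.measurePreserving_homeomorphUnitSphereProd.integral_comp
          (Homeomorph.measurableEmbedding _)
          (fun x : S2 × Set.Ioi (0 : ℝ) => h x.1 * φ x.2))
      change φ ‖x.1‖ * radialExt h x.1 = _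
      rw [mul_comm, radialExt, dif_neg (show ¬ (x : E3) = 0 from x.2),
        homeomorphUnitSphereProd_apply_snd_coe]
      congr 2
      ext1
      rw [homeomorphUnitSphereProd_apply_fst_coe]
    _ = _ := integral_prod_mul h fun r : Set.Ioi (0 : ℝ) => φ r

theorem SmoothS2.integrable {g : S2 → ℝ} (hg : SmoothS2 g) :
    Integrable g ((volume : Measure E3).toSphere) :=
  (ContMDiff.continuous hg).integrable_of_hasCompactSupport (HasCompactSupport.of_compactSpace g)

/-- The integral of the derivative of a compactly supported function along a rotation vanishes. -/
theorem integral_fderiv_rotation_eq_zero {A : E3 →L[ℝ] E3} (hA : IsSkew A) {G : E3 → ℝ}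
    (hG : ContDiff ℝ ∞ G) (hc : HasCompactSupport G) : ∫ x, fderiv ℝ G x (A x) = 0 := by
  let b := EuclideanSpace.basisFun (Fin 3) ℝ
  have hG' : Continuous (fderiv ℝ G) := hG.continuous_fderiv (by simp)
  have hsum : ∀ x, fderiv ℝ G x (A x) = ∑ i, ⟪b i, A x⟫ * fderiv ℝ G x (b i) := fun x => by
    conv_lhs => rw [← b.sum_repr' (A x)]
    simp
  have hci : ∀ i, HasCompactSupport fun x => fderiv ℝ G x (b i) := fun i =>
    (hc.fderiv ℝ).comp_left (g := fun L : E3 →L[ℝ] ℝ => L (b i)) rfl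
  have hlin : ∀ i x, HasFDerivAt (fun x => ⟪b i, A x⟫) ((innerSL ℝ (b i)).comp A) x := fun i x =>
    (innerSL ℝ (b i)).hasFDerivAt.comp x A.hasFDerivAt
  have hi1 : ∀ i, Integrable fun x => ⟪b i, A x⟫ * fderiv ℝ G x (b i) := fun i =>
    Continuous.integrable_of_hasCompactSupport (by fun_prop) (hci i).mul_left
  have hi : ∀ i, ∫ x, ⟪b i, A x⟫ * fderiv ℝ G x (b i) = 0 := fun i => by
    -- The diagonal entries of a skew `A` vanish, so integration by parts in each coordinate leaves
    -- no term.
    have hz : ∀ x, fderiv ℝ (fun x => ⟪b i, A x⟫) x (b i) = 0 := fun x => by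
      rw [(hlin i x).fderiv]
      exact hA.inner_self _
    rw [integral_mul_fderiv_eq_neg_fderiv_mul_of_integrable _ (hi1 i)
      (Continuous.integrable_of_hasCompactSupport (by fun_prop) hc.mul_left)
      (fun x _ => (hlin i x).differentiableAt)
      fun x _ => (hG.differentiable (by simp)).differentiableAt]
    · simp [hz]
    · simp [hz]
  simp_rw [hsum]
  rw [integral_finsetSum _ fun i _ => hi1 i]
  exact Finset.sum_eq_zero fun i _ => hi i

/-- The integral over the sphere of the derivative along a rotation vanishes. -/
theorem integralS2_rotation_eq_zero {A : E3 →L[ℝ] E3} (hA : IsSkew A) {g : S2 → ℝ}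
    (hg : SmoothS2 g) : integralS2 (fun n => dS g n (A n)) = 0 := by
  -- `ψ(‖x‖²)` is supported in the shell `1 ≤ ‖x‖² ≤ 3`, away from the singularity of `radialExt` at
  -- the origin, and being radial it is invariant under rotations.
  let ψ : ContDiffBump (2 : ℝ) := ⟨1 / 2, 1, by norm_num, by norm_num⟩
  let φ : E3 → ℝ := fun x => ψ (‖x‖ ^ 2)
  have hφ : ContDiff ℝ ∞ φ := ψ.contDiff.comp (contDiff_norm_sq ℝ)
  have hφ0 : ∀ x : E3, ‖x‖ ^ 2 ≤ 1 → φ x = 0 := fun x hx =>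
    ψ.zero_of_le_dist (by
      change 1 ≤ |‖x‖ ^ 2 - 2|
      rw [abs_of_nonpos (by linarith)]
      linarith)
  have hφc : HasCompactSupport φ := by
    refine HasCompactSupport.intro (isCompact_closedBall (0 : E3) 2) fun x hx => ?_
    rw [mem_closedBall_zero_iff, not_le] at hx
    refine ψ.zero_of_le_dist ?_
    change 1 ≤ |‖x‖ ^ 2 - 2|
    rw [abs_of_nonneg (by nlinarith)]
    nlinarith
  let c := ∫ r : Set.Ioi (0 : ℝ), ψ ((r : ℝ) ^ 2)
    ∂(Measure.volumeIoiPow (Module.finrank ℝ E3 - 1))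
  have hpolar : ∀ h : S2 → ℝ, ∫ x : E3, φ x * radialExt h x = integralS2 h * c := fun h =>
    integral_norm_mul_radialExt (fun r => ψ (r ^ 2)) h
  -- For `h = 1` the polar formula writes `∫ φ` as a multiple of `c`, and `∫ φ > 0` because `φ = 1`
  -- where `‖x‖² = 2`.
  have hc : c ≠ 0 := by
    intro h0
    have h1 := hpolar fun _ => 1
    rw [h0, mul_zero] at h1
    have h2 : (fun x : E3 => φ x * radialExt (fun _ => (1 : ℝ)) x) = φ := by
      funext x
      by_cases hx : x = 0
      · rw [hφ0 x (by simp [hx]), zero_mul]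
      · rw [radialExt, dif_neg hx, mul_one]
    rw [h2] at h1
    refine (hφ.continuous.integral_pos_of_hasCompactSupport_nonneg_nonzero hφc
      (fun x => ψ.nonneg) (x := Real.sqrt 2 • EuclideanSpace.single 0 1) ?_).ne' h1
    have h3 : φ (Real.sqrt 2 • EuclideanSpace.single 0 1) = ψ 2 := by
      simp [φ, norm_smul]
    rw [h3, ψ.one_of_mem_closedBall (Metric.mem_closedBall_self (by norm_num [ψ]))]
    exact one_ne_zero
  have hG : ContDiff ℝ ∞ fun x => φ x * radialExt g x := by
    rw [contDiff_iff_contDiffAt]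
    intro x
    by_cases hx : x = 0
    · refine (contDiffAt_const (c := (0 : ℝ))).congr_of_eventuallyEq ?_
      filter_upwards [(continuous_norm.pow 2).continuousAt.eventually_lt_const
        (show ‖x‖ ^ 2 < 1 by simp [hx])] with y hy
      rw [hφ0 y hy.le, zero_mul]
    · exact hφ.contDiffAt.mul (hg.contDiffAt_radialExt hx)
  -- The derivative of `φ` along `A x` is proportional to `⟪x, A x⟫ = 0`.
  have hD : ∀ x, fderiv ℝ (fun x => φ x * radialExt g x) x (A x) =
      φ x * radialExt (fun n => dS g n (A n)) x := by
    intro x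
    by_cases hx : x = 0
    · rw [hφ0 x (by simp [hx]), zero_mul, hx, map_zero, map_zero]
    · have h1 : HasFDerivAt φ _ x :=
        ((ψ.contDiff (n := 1)).differentiable one_ne_zero).differentiableAt.hasFDerivAt.comp x
          (hasStrictFDerivAt_norm_sq x).hasFDerivAt
      have h2 : HasFDerivAt (fun x => φ x * radialExt g x) _ x :=
        h1.mul ((hg.contDiffAt_radialExt hx).differentiableAt (by simp)).hasFDerivAt
      rw [h2.fderiv, radialExt_dS_apply]
      simp [hA.inner_self]
  have h := integral_fderiv_rotation_eq_zero hA hG hφc.mul_right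
  simp_rw [hD] at h
  rw [hpolar] at h
  exact (mul_eq_zero.1 h).resolve_right hc

end Integral

/-! ### The central term is a 2-cocycle on boundary data -/

section Linearity

theorem gradS_add {W W' : S2 → ℝ} (hW : SmoothS2 W) (hW' : SmoothS2 W') :
    gradS (W + W') = gradS W + gradS W' := by
  funext n
  have h := dS_add hW hW' n
  simp only [dS] at h
  simp [gradS, gradient, h]

theorem gradS_smul (c : ℝ) {W : S2 → ℝ} (hW : SmoothS2 W) : gradS (c • W) = c • gradS W := by
  funext n
  have h := dS_smul c hW n
  simp only [dS] at h
  simp [gradS, gradient, h]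

theorem divS_add {K K' : S2 → E3} (hK : SmoothS2 K) (hK' : SmoothS2 K') :
    divS (K + K') = divS K + divS K' := by
  funext n
  simp [divS_eq, dS_add hK hK']

theorem divS_smul (c : ℝ) {K : S2 → E3} (hK : SmoothS2 K) : divS (c • K) = c • divS K := by
  funext n
  simp [divS_eq, dS_smul c hK]

theorem dS_sub {V : Type} [NormedAddCommGroup V] [NormedSpace ℝ V] {g h : S2 → V}
    (hg : SmoothS2 g) (hh : SmoothS2 h) (n : S2) : dS (g - h) n = dS g n - dS h n := by
  have h' : SmoothS2 ((-1 : ℝ) • h) := (contDiff_const_smul (-1 : ℝ)).contMDiff.comp hh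
  rw [show g - h = g + (-1 : ℝ) • h by rw [neg_one_smul, sub_eq_add_neg], dS_add hg h',
    dS_smul _ hh, neg_one_smul, sub_eq_add_neg]

theorem dS_mul {g h : S2 → ℝ} (hg : SmoothS2 g) (hh : SmoothS2 h) (n : S2) (u : E3) :
    dS (g * h) n u = dS g n u * h n + g n * dS h n u := by
  have e : radialExt (g * h) = radialExt g * radialExt h := by
    refine (eq_radialExt (by simp [radialExt]) fun r m hr => ?_).symm
    simp [radialExt_smul _ hr, radialExt_coe]
  rw [dS, e, ((hg.differentiableAt_radialExt n).hasFDerivAt.mul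
    (hh.differentiableAt_radialExt n).hasFDerivAt).fderiv]
  simp [radialExt_coe, dS]
  ring

theorem integralS2_add {g h : S2 → ℝ} (hg : SmoothS2 g) (hh : SmoothS2 h) :
    integralS2 (g + h) = integralS2 g + integralS2 h :=
  MeasureTheory.integral_add hg.integrable hh.integrable

theorem integralS2_sub {g h : S2 → ℝ} (hg : SmoothS2 g) (hh : SmoothS2 h) :
    integralS2 (g - h) = integralS2 g - integralS2 h :=
  MeasureTheory.integral_sub hg.integrable hh.integrable

theorem integralS2_smul (c : ℝ) (g : S2 → ℝ) : integralS2 (c • g) = c * integralS2 g :=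
  MeasureTheory.integral_const_mul c g

end Linearity

/-! ### The flux, bilinearity of the central term and the cocycle identity -/

namespace BoundaryData

variable {d e z : BoundaryData}

/-- The divergence `D^A D_A W - D_A I^A` that enters the central term. -/
noncomputable def flux (d : BoundaryData) : S2 → ℝ := divS (gradS d.W - d.I)

theorem IsAdmissible.smooth_grad_sub (hd : d.IsAdmissible) : SmoothS2 (gradS d.W - d.I) :=
  ContMDiff.sub hd.smooth_W.gradS hd.smooth_I

theorem IsAdmissible.smooth_flux (hd : d.IsAdmissible) : SmoothS2 d.flux :=
  hd.smooth_grad_sub.divS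

theorem IsAdmissible.flux_apply (hd : d.IsAdmissible) (n : S2) :
    d.flux n = laplS d.W n - divS d.I n := by
  rw [flux, laplS, divS_eq, divS_eq, divS_eq, dS_sub hd.smooth_W.gradS hd.smooth_I, map_sub]

theorem IsAdmissible.flux_add (hd : d.IsAdmissible) (he : e.IsAdmissible) :
    (d + e).flux = d.flux + e.flux := by
  rw [flux, flux, flux, ← divS_add hd.smooth_grad_sub he.smooth_grad_sub,
    show (d + e).W = d.W + e.W from rfl, gradS_add hd.smooth_W he.smooth_W,
    show (d + e).I = d.I + e.I from rfl, add_sub_add_comm]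

theorem IsAdmissible.flux_smul (c : ℝ) (hd : d.IsAdmissible) : (c • d).flux = c • d.flux := by
  rw [flux, flux, ← divS_smul c hd.smooth_grad_sub,
    show (c • d).W = c • d.W from rfl, gradS_smul c hd.smooth_W,
    show (c • d).I = c • d.I from rfl, smul_sub]

theorem centralTerm_eq (s : ℝ) (hd : d.IsAdmissible) (he : e.IsAdmissible) :
    centralTerm s d e = -s * 2 * (integralS2 (e.f * d.flux) - integralS2 (d.f * e.flux)) := by
  rw [← integralS2_sub (ContMDiff.mul he.smooth_f hd.smooth_flux)
    (ContMDiff.mul hd.smooth_f he.smooth_flux), centralTerm]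
  congr 2
  funext n
  simp [hd.flux_apply, he.flux_apply]

theorem centralTerm_swap (s : ℝ) (hd : d.IsAdmissible) (he : e.IsAdmissible) :
    centralTerm s d e = -centralTerm s e d := by
  rw [centralTerm_eq s hd he, centralTerm_eq s he hd]
  ring

theorem centralTerm_add_left (s : ℝ) (hd : d.IsAdmissible) (he : e.IsAdmissible)
    (hz : z.IsAdmissible) :
    centralTerm s (d + e) z = centralTerm s d z + centralTerm s e z := by
  rw [centralTerm_eq s (hd.add he) hz, centralTerm_eq s hd hz, centralTerm_eq s he hz,
    hd.flux_add he, show (d + e).f = d.f + e.f from rfl, mul_add, add_mul,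
    integralS2_add (ContMDiff.mul hz.smooth_f hd.smooth_flux)
      (ContMDiff.mul hz.smooth_f he.smooth_flux),
    integralS2_add (ContMDiff.mul hd.smooth_f hz.smooth_flux)
      (ContMDiff.mul he.smooth_f hz.smooth_flux)]
  ring

theorem centralTerm_smul_left (s c : ℝ) (hd : d.IsAdmissible) (hz : z.IsAdmissible) :
    centralTerm s (c • d) z = c * centralTerm s d z := by
  rw [centralTerm_eq s (hd.smul c) hz, centralTerm_eq s hd hz, hd.flux_smul,
    show (c • d).f = c • d.f from rfl, mul_smul_comm, smul_mul_assoc, integralS2_smul,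
    integralS2_smul]
  ring

/-- Both `grad W` and `I` change by Lie derivatives along the rotations, so `grad W - I` does too,
and the divergence commutes with them. The flux thus transforms as a scalar, exactly like `f`. -/
theorem flux_bracket (hd : d.IsAdmissible) (he : e.IsAdmissible) :
    (d.bracket e).flux = fun n => dS e.flux n (d.Y n) - dS d.flux n (e.Y n) := by
  obtain ⟨A, hA, hA'⟩ := hd.killing_Y.exists_isSkew hd.smooth_Y hd.tangent_Y
  obtain ⟨B, hB, hB'⟩ := he.killing_Y.exists_isSkew he.smooth_Y he.tangent_Y
  have smooth_rot : ∀ {C : E3 →L[ℝ] E3} {K : S2 → E3}, SmoothS2 K →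
      SmoothS2 fun m => dS K m (C m) - C (K m) := fun {C K} hK =>
    ContMDiff.sub (hK.dS_apply C) (C.contDiff.contMDiff.comp hK)
  have hW : gradS (d.bracket e).W = fun n =>
      (dS (gradS e.W) n (A n) - A (gradS e.W n)) - (dS (gradS d.W) n (B n) - B (gradS d.W n)) := by
    have h : (d.bracket e).W = (fun n => dS e.W n (A n)) + (-1 : ℝ) • fun n => dS d.W n (B n) := by
      funext n
      simp [← hA', ← hB', ← sub_eq_add_neg]
      rfl
    have hs : SmoothS2 ((-1 : ℝ) • fun n => dS d.W n (B n)) :=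
      (contDiff_const_smul (-1 : ℝ)).contMDiff.comp (hd.smooth_W.dS_apply B)
    funext n
    rw [h, gradS_add (he.smooth_W.dS_apply A) hs,
      gradS_smul _ (hd.smooth_W.dS_apply B)]
    simp [gradS_rotation hA he.smooth_W, gradS_rotation hB hd.smooth_W]
    abel
  have hI : (d.bracket e).I = fun n =>
      (dS e.I n (A n) - A (e.I n)) - (dS d.I n (B n) - B (d.I n)) := by
    funext n
    -- Since `Y` is linear, its derivative along `I` is the rotation applied to `I`; this completes
    -- `dS I (Y n)` to a Lie derivative.
    rw [bracket_I hd he, dS_of_linear hB' (hd.tangent_I n), dS_of_linear hA' (he.tangent_I n),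
      hA', hB']
    abel
  have h : gradS (d.bracket e).W - (d.bracket e).I =
      (fun n => dS (gradS e.W - e.I) n (A n) - A ((gradS e.W - e.I) n)) -
      fun n => dS (gradS d.W - d.I) n (B n) - B ((gradS d.W - d.I) n) := by
    funext n
    simp only [hW, hI, Pi.sub_apply, dS_sub he.smooth_W.gradS he.smooth_I,
      dS_sub hd.smooth_W.gradS hd.smooth_I, sub_apply, map_sub]
    abel
  funext n
  rw [flux, h, divS_eq, dS_sub (smooth_rot he.smooth_grad_sub) (smooth_rot hd.smooth_grad_sub),
    map_sub, ← divS_eq, ← divS_eq, divS_rotation hA he.smooth_grad_sub,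
    divS_rotation hB hd.smooth_grad_sub, hA', hB']
  rfl

theorem IsAdmissible.smooth_dS_Y (hd : d.IsAdmissible) {V : Type} [NormedAddCommGroup V]
    [NormedSpace ℝ V] {g : S2 → V} (hg : SmoothS2 g) : SmoothS2 fun n => dS g n (d.Y n) := by
  obtain ⟨A, hA, hA'⟩ := hd.killing_Y.exists_isSkew hd.smooth_Y hd.tangent_Y
  simp only [hA']
  exact hg.dS_apply A

/-- Integration by parts along a Killing vector field. -/
theorem IsAdmissible.integralS2_by_parts (hd : d.IsAdmissible) {g h : S2 → ℝ} (hg : SmoothS2 g)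
    (hh : SmoothS2 h) :
    integralS2 ((fun n => dS g n (d.Y n)) * h) + integralS2 ((fun n => dS h n (d.Y n)) * g) = 0 := by
  rw [← integralS2_add (ContMDiff.mul (hd.smooth_dS_Y hg) hh)
    (ContMDiff.mul (hd.smooth_dS_Y hh) hg)]
  obtain ⟨A, hA, hA'⟩ := hd.killing_Y.exists_isSkew hd.smooth_Y hd.tangent_Y
  rw [← integralS2_rotation_eq_zero hA (g := g * h) (ContMDiff.mul hg hh)]
  congr 1
  funext n
  simp [dS_mul hg hh, hA', mul_comm]

theorem centralTerm_bracket (s : ℝ) (hd : d.IsAdmissible) (he : e.IsAdmissible)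
    (hz : z.IsAdmissible) (hde : (d.bracket e).IsAdmissible) :
    centralTerm s (d.bracket e) z = -s * 2 *
      (integralS2 ((fun n => dS e.flux n (d.Y n)) * z.f)
        - integralS2 ((fun n => dS d.flux n (e.Y n)) * z.f)
        - (integralS2 ((fun n => dS e.f n (d.Y n)) * z.flux)
        - integralS2 ((fun n => dS d.f n (e.Y n)) * z.flux))) := by
  rw [centralTerm_eq s hde hz, flux_bracket hd he,
    ← integralS2_sub (ContMDiff.mul (hd.smooth_dS_Y he.smooth_flux) hz.smooth_f)
      (ContMDiff.mul (he.smooth_dS_Y hd.smooth_flux) hz.smooth_f),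
    ← integralS2_sub (ContMDiff.mul (hd.smooth_dS_Y he.smooth_f) hz.smooth_flux)
      (ContMDiff.mul (he.smooth_dS_Y hd.smooth_f) hz.smooth_flux), ← sub_mul, ← sub_mul,
    mul_comm z.f]
  rfl

/-- The three brackets expand into twelve integrals. Each pairs off with the one having the same
Killing field, flux and `f`, with the derivative moved to the other factor; the six pairs vanish by
parts. -/
theorem centralTerm_cocycle (s : ℝ) {x y z : BoundaryData} (hx : x.IsAdmissible)
    (hy : y.IsAdmissible) (hz : z.IsAdmissible) (hxy : (x.bracket y).IsAdmissible)
    (hyz : (y.bracket z).IsAdmissible) (hzx : (z.bracket x).IsAdmissible) :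
    centralTerm s (x.bracket y) z + centralTerm s (y.bracket z) x
      + centralTerm s (z.bracket x) y = 0 := by
  rw [centralTerm_bracket s hx hy hz hxy, centralTerm_bracket s hy hz hx hyz,
    centralTerm_bracket s hz hx hy hzx]
  have h1 := hx.integralS2_by_parts hy.smooth_flux hz.smooth_f
  have h2 := hx.integralS2_by_parts hz.smooth_flux hy.smooth_f
  have h3 := hy.integralS2_by_parts hz.smooth_flux hx.smooth_f
  have h4 := hy.integralS2_by_parts hx.smooth_flux hz.smooth_f
  have h5 := hz.integralS2_by_parts hx.smooth_flux hy.smooth_f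
  have h6 := hz.integralS2_by_parts hy.smooth_flux hx.smooth_f
  linear_combination (-s * 2) * (h1 - h2 + h3 - h4 + h5 - h6)

end BoundaryData

/-! ### The Lie algebra of smearing fields -/

namespace SmearingField

variable {a b c : SmearingField}

theorem bracket_swap (a b : SmearingField) : bracket a b = -bracket b a :=
  Prod.ext (funext fun _ => (neg_sub _ _).symm) (funext fun _ => VectorField.lieBracket_swap)

theorem bracket_add_left (ha : a.IsAdmissible) (hb : b.IsAdmissible) (c : SmearingField) :
    bracket (a + b) c = bracket a c + bracket b c := by
  refine Prod.ext (funext fun x => ?_) (funext fun x => ?_)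
  · simp only [bracket, Prod.fst_add, Prod.snd_add, Pi.add_apply, map_add]
    rw [fderiv_add (ha.smooth_time.differentiable (by simp)).differentiableAt
      (hb.smooth_time.differentiable (by simp)).differentiableAt, add_apply]
    ring
  · exact VectorField.lieBracket_add_left
      (ha.smooth_space.differentiable (by simp)).differentiableAt
      (hb.smooth_space.differentiable (by simp)).differentiableAt

theorem bracket_smul_left (r : ℝ) (ha : a.IsAdmissible) (c : SmearingField) :
    bracket (r • a) c = r • bracket a c := by
  refine Prod.ext (funext fun x => ?_) (funext fun x => ?_)
  · simp only [bracket, Prod.smul_fst, Prod.smul_snd, Pi.smul_apply, map_smul]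
    rw [fderiv_const_smul (ha.smooth_time.differentiable (by simp)).differentiableAt, smul_apply,
      smul_sub]
  · exact VectorField.lieBracket_const_smul_left
      (ha.smooth_space.differentiable (by simp)).differentiableAt

/-- A smearing field as a vector field on `ℝ³ × ℝ` that does not depend on the last coordinate. -/
def toVectorField (a : SmearingField) (p : E3 × ℝ) : E3 × ℝ := (a.2 p.1, a.1 p.1)

theorem contDiff_toVectorField (ha : a.IsAdmissible) : ContDiff ℝ ∞ a.toVectorField :=
  (ha.smooth_space.comp contDiff_fst).prodMk (ha.smooth_time.comp contDiff_fst)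

theorem fderiv_toVectorField (ha : a.IsAdmissible) (p v : E3 × ℝ) :
    fderiv ℝ a.toVectorField p v = (fderiv ℝ a.2 p.1 v.1, fderiv ℝ a.1 p.1 v.1) := by
  have h : HasFDerivAt a.toVectorField _ p :=
    ((ha.smooth_space.differentiable (by simp)).differentiableAt.hasFDerivAt.comp p
      hasFDerivAt_fst).prodMk
    ((ha.smooth_time.differentiable (by simp)).differentiableAt.hasFDerivAt.comp p hasFDerivAt_fst)
  rw [h.fderiv]
  rfl

theorem lieBracket_toVectorField (ha : a.IsAdmissible) (hb : b.IsAdmissible) :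
    VectorField.lieBracket ℝ a.toVectorField b.toVectorField = (a.bracket b).toVectorField := by
  funext p
  rw [VectorField.lieBracket, fderiv_toVectorField ha, fderiv_toVectorField hb]
  rfl

/-- This is the Jacobi identity for vector fields on `ℝ³ × ℝ`: for fields independent of the last
coordinate, the last component of the Lie bracket is the time part of `bracket`. -/
theorem bracket_leibniz (ha : a.IsAdmissible) (hb : b.IsAdmissible) (hc : c.IsAdmissible) :
    a.bracket (b.bracket c) = (a.bracket b).bracket c + b.bracket (a.bracket c) := by
  have key : ∀ p, (a.bracket (b.bracket c)).toVectorField p =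
      ((a.bracket b).bracket c).toVectorField p + (b.bracket (a.bracket c)).toVectorField p := by
    intro p
    rw [← lieBracket_toVectorField ha (hb.bracket hc), ← lieBracket_toVectorField hb hc,
      ← lieBracket_toVectorField (ha.bracket hb) hc, ← lieBracket_toVectorField ha hb,
      ← lieBracket_toVectorField hb (ha.bracket hc), ← lieBracket_toVectorField ha hc]
    refine VectorField.leibniz_identity_lieBracket (n := ∞) ?_
      (contDiff_toVectorField ha).contDiffAt (contDiff_toVectorField hb).contDiffAt
      (contDiff_toVectorField hc).contDiffAt
    rw [minSmoothness_of_isRCLikeNormedField]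
    exact WithTop.coe_le_coe.2 le_top
  exact Prod.ext (funext fun x => congrArg Prod.snd (key (x, 0)))
    (funext fun x => congrArg Prod.fst (key (x, 0)))

/-- The bracket of smearing fields as a bilinear map. -/
noncomputable def bracketₗ : smearingSpace →ₗ[ℝ] smearingSpace →ₗ[ℝ] smearingSpace :=
  LinearMap.mk₂ ℝ (fun a b => ⟨bracket a b, IsAdmissible.bracket a.2 b.2⟩)
    (fun a b c => Subtype.ext (bracket_add_left a.2 b.2 c))
    (fun r a c => Subtype.ext (bracket_smul_left r a.2 c))
    (fun a b c => Subtype.ext <| by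
      change bracket a.1 (b.1 + c.1) = bracket a.1 b.1 + bracket a.1 c.1
      rw [bracket_swap, bracket_add_left b.2 c.2, bracket_swap a.1, bracket_swap a.1, neg_add])
    (fun r a b => Subtype.ext <| by
      change bracket a.1 (r • b.1) = r • bracket a.1 b.1
      rw [bracket_swap, bracket_smul_left r b.2, bracket_swap a.1, smul_neg])

theorem isLieBracket_bracketₗ : IsLieBracket bracketₗ := by
  have alt : ∀ x, bracketₗ x x = 0 := fun x => Subtype.ext <| by
    refine Prod.ext (funext fun _ => sub_self _) (VectorField.lieBracket_self)
  have swap : ∀ x y, bracketₗ x y = -bracketₗ y x := fun x y => Subtype.ext (bracket_swap x.1 y.1)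
  refine ⟨alt, fun x y z => ?_⟩
  have h : bracketₗ x (bracketₗ y z) = bracketₗ (bracketₗ x y) z + bracketₗ y (bracketₗ x z) :=
    Subtype.ext (bracket_leibniz x.2 y.2 z.2)
  rw [swap x (bracketₗ y z), swap y (bracketₗ x z), swap x z] at h
  rw [map_neg, LinearMap.neg_apply, neg_neg] at h
  rw [add_right_comm, ← h, neg_add_cancel]

/-- The boundary data of a smearing field. -/
noncomputable def boundaryData (a : smearingSpace) : boundarySpace :=
  ⟨a.2.falloff.choose, a.2.falloff.choose_spec.1⟩

theorem hasBoundaryData_boundaryData (a : smearingSpace) :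
    HasBoundaryData a (boundaryData a : BoundaryData) := a.2.falloff.choose_spec.2

theorem hasBoundaryData_iff_eq (a : smearingSpace) (d : BoundaryData) :
    HasBoundaryData a d ↔ d = boundaryData a :=
  ⟨fun h => HasBoundaryData.unique h (hasBoundaryData_boundaryData a),
    fun h => h ▸ hasBoundaryData_boundaryData a⟩

/-- The linear map from smearing fields to their boundary data. -/
noncomputable def boundaryDataₗ : smearingSpace →ₗ[ℝ] boundarySpace where
  toFun := boundaryData
  map_add' := fun a b => Subtype.ext <| Eq.symm <| (hasBoundaryData_iff_eq (a + b) _).1 <|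
    (hasBoundaryData_boundaryData a).add (hasBoundaryData_boundaryData b)
  map_smul' := fun r a => Subtype.ext <| Eq.symm <| (hasBoundaryData_iff_eq (r • a) _).1 <|
    (hasBoundaryData_boundaryData a).smul r

/-- Surjectivity lets the algebraic laws of the bracket descend from smearing fields to boundary
data. -/
theorem boundaryDataₗ_surjective : Function.Surjective boundaryDataₗ := fun d => by
  obtain ⟨a, ha, had⟩ := BoundaryData.IsAdmissible.exists_hasBoundaryData d.2
  exact ⟨⟨a, ha⟩, Subtype.ext ((hasBoundaryData_iff_eq ⟨a, ha⟩ _).1 had).symm⟩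

theorem boundaryDataₗ_bracketₗ (a b : smearingSpace) :
    (boundaryDataₗ (bracketₗ a b) : BoundaryData) =
      BoundaryData.bracket (boundaryDataₗ a) (boundaryDataₗ b) :=
  ((hasBoundaryData_iff_eq (bracketₗ a b) _).1
    (HasBoundaryData.bracket (hasBoundaryData_boundaryData a) (hasBoundaryData_boundaryData b)
      (boundaryData a).2 (boundaryData b).2).1).symm

end SmearingField

/-! ### The Lie algebra of boundary data and the central extensions -/

section Extension

open SmearingField

/-- Realizing the data by smearing fields reads the regularity of the bracket off the expansion of
their commutator. -/
theorem BoundaryData.IsAdmissible.bracket {d e : BoundaryData} (hd : d.IsAdmissible)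
    (he : e.IsAdmissible) : (d.bracket e).IsAdmissible := by
  obtain ⟨a, _, had⟩ := hd.exists_hasBoundaryData
  obtain ⟨b, _, hbe⟩ := he.exists_hasBoundaryData
  exact (HasBoundaryData.bracket had hbe hd he).2

/-- The bracket of two admissible boundary data. -/
noncomputable def boundaryBracket (d e : boundarySpace) : boundarySpace :=
  ⟨BoundaryData.bracket d e, BoundaryData.IsAdmissible.bracket d.2 e.2⟩

theorem boundaryBracket_boundaryDataₗ (a b : smearingSpace) :
    boundaryBracket (boundaryDataₗ a) (boundaryDataₗ b) = boundaryDataₗ (bracketₗ a b) :=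
  Subtype.ext (boundaryDataₗ_bracketₗ a b).symm

/-- The bracket of boundary data as a bilinear map. -/
noncomputable def boundaryBracketₗ : boundarySpace →ₗ[ℝ] boundarySpace →ₗ[ℝ] boundarySpace :=
  LinearMap.mk₂ ℝ boundaryBracket
    -- Each law is lifted along the surjection `boundaryDataₗ` and becomes the same law for
    -- `bracketₗ`.
    (fun d e z => by
      obtain ⟨a, rfl⟩ := boundaryDataₗ_surjective d
      obtain ⟨b, rfl⟩ := boundaryDataₗ_surjective e
      obtain ⟨c, rfl⟩ := boundaryDataₗ_surjective z
      simp only [← map_add, boundaryBracket_boundaryDataₗ]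
      rw [map_add bracketₗ, LinearMap.add_apply])
    (fun r d z => by
      obtain ⟨a, rfl⟩ := boundaryDataₗ_surjective d
      obtain ⟨c, rfl⟩ := boundaryDataₗ_surjective z
      simp only [← map_smul, boundaryBracket_boundaryDataₗ]
      rw [map_smul bracketₗ, LinearMap.smul_apply, map_smul (bracketₗ a)])
    (fun d e z => by
      obtain ⟨a, rfl⟩ := boundaryDataₗ_surjective d
      obtain ⟨b, rfl⟩ := boundaryDataₗ_surjective e
      obtain ⟨c, rfl⟩ := boundaryDataₗ_surjective z
      simp only [← map_add, boundaryBracket_boundaryDataₗ])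
    (fun r d z => by
      obtain ⟨a, rfl⟩ := boundaryDataₗ_surjective d
      obtain ⟨c, rfl⟩ := boundaryDataₗ_surjective z
      simp only [← map_smul, boundaryBracket_boundaryDataₗ])

theorem boundaryBracketₗ_boundaryDataₗ (a b : smearingSpace) :
    boundaryBracketₗ (boundaryDataₗ a) (boundaryDataₗ b) = boundaryDataₗ (bracketₗ a b) :=
  boundaryBracket_boundaryDataₗ a b

theorem isLieBracket_boundaryBracketₗ : IsLieBracket boundaryBracketₗ where
  alternating := fun d => by
    obtain ⟨a, rfl⟩ := boundaryDataₗ_surjective d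
    rw [boundaryBracketₗ_boundaryDataₗ, isLieBracket_bracketₗ.alternating, map_zero]
  jacobi := fun d e z => by
    obtain ⟨a, rfl⟩ := boundaryDataₗ_surjective d
    obtain ⟨b, rfl⟩ := boundaryDataₗ_surjective e
    obtain ⟨c, rfl⟩ := boundaryDataₗ_surjective z
    simp only [boundaryBracketₗ_boundaryDataₗ, ← map_add]
    rw [isLieBracket_bracketₗ.jacobi, map_zero]

/-- The central term as a bilinear form. -/
noncomputable def centralTermₗ (s : ℝ) : boundarySpace →ₗ[ℝ] boundarySpace →ₗ[ℝ] ℝ :=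
  LinearMap.mk₂ ℝ (fun d e => BoundaryData.centralTerm s d e)
    (fun d e z => BoundaryData.centralTerm_add_left s d.2 e.2 z.2)
    (fun r d z => BoundaryData.centralTerm_smul_left s r d.2 z.2)
    (fun d e z => by
      rw [BoundaryData.centralTerm_swap s d.2 (e + z).2, BoundaryData.centralTerm_swap s d.2 e.2,
        BoundaryData.centralTerm_swap s d.2 z.2, ← neg_add]
      exact congrArg Neg.neg (BoundaryData.centralTerm_add_left s e.2 z.2 d.2))
    (fun r d z => by
      rw [BoundaryData.centralTerm_swap s d.2 (r • z).2, BoundaryData.centralTerm_swap s d.2 z.2,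
        smul_neg]
      exact congrArg Neg.neg (BoundaryData.centralTerm_smul_left s r z.2 d.2))

theorem isTwoCocycle_centralTermₗ (s : ℝ) : IsTwoCocycle boundaryBracketₗ (centralTermₗ s) where
  antisymmetric := fun d e => BoundaryData.centralTerm_swap s d.2 e.2
  cocycle := fun d e z => BoundaryData.centralTerm_cocycle s d.2 e.2 z.2
    (BoundaryData.IsAdmissible.bracket d.2 e.2) (BoundaryData.IsAdmissible.bracket e.2 z.2)
    (BoundaryData.IsAdmissible.bracket z.2 d.2)

/-! ### From a 2-cocycle to a central extension, and pullback of cocycles -/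

variable {L M : Type} [AddCommGroup L] [Module ℝ L] [AddCommGroup M] [Module ℝ M]

/-- A 2-cocycle defines a central extension. -/
theorem IsTwoCocycle.isCentralExtension {br : L →ₗ[ℝ] L →ₗ[ℝ] L} {Ω : L →ₗ[ℝ] L →ₗ[ℝ] ℝ}
    (hΩ : IsTwoCocycle br Ω) (hbr : IsLieBracket br) : IsCentralExtension br Ω where
  base := hbr
  extension :=
    { alternating := fun x => Prod.ext (hbr.alternating x.1)
        (by
          have h := hΩ.antisymmetric x.1 x.1
          change Ω x.1 x.1 = 0
          linarith)
      jacobi := fun x y z => Prod.ext (hbr.jacobi x.1 y.1 z.1) (hΩ.cocycle x.1 y.1 z.1) }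
  central := fun c x => by simp [extensionBracket]
  projection := fun x y => rfl

/-- The pullback of a 2-cocycle along a homomorphism. -/
theorem IsTwoCocycle.comp {br : L →ₗ[ℝ] L →ₗ[ℝ] L} {br' : M →ₗ[ℝ] M →ₗ[ℝ] M}
    {Ω : L →ₗ[ℝ] L →ₗ[ℝ] ℝ} (hΩ : IsTwoCocycle br Ω) {φ : M →ₗ[ℝ] L}
    (hφ : ∀ x y, φ (br' x y) = br (φ x) (φ y)) : IsTwoCocycle br' (Ω.compl₁₂ φ φ) where
  antisymmetric := fun x y => hΩ.antisymmetric (φ x) (φ y)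
  cocycle := fun x y z => by
    simp only [LinearMap.compl₁₂_apply, hφ]
    exact hΩ.cocycle (φ x) (φ y) (φ z)

end Extension

end DustSymmetry

theorem mainTheorem5 (s : ℝ) (hs : s = 1 ∨ s = -1) :
    ∃ (brB : boundarySpace →ₗ[ℝ] boundarySpace →ₗ[ℝ] boundarySpace)
      (brG : smearingSpace →ₗ[ℝ] smearingSpace →ₗ[ℝ] smearingSpace)
      (π : smearingSpace →ₗ[ℝ] boundarySpace)
      (ΩB : boundarySpace →ₗ[ℝ] boundarySpace →ₗ[ℝ] ℝ)
      (ΩG : smearingSpace →ₗ[ℝ] smearingSpace →ₗ[ℝ] ℝ),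
      (∀ d e : boundarySpace, (brB d e : BoundaryData) = BoundaryData.bracket d e) ∧
      (∀ a b : smearingSpace, (brG a b : SmearingField) = SmearingField.bracket a b) ∧
      (∀ (a : smearingSpace) (d : BoundaryData),
        SmearingField.HasBoundaryData a d ↔ d = (π a : BoundaryData)) ∧
      (∀ a b : smearingSpace, π (brG a b) = brB (π a) (π b)) ∧
      (∀ d e : boundarySpace, ΩB d e = BoundaryData.centralTerm s d e) ∧
      (∀ a b : smearingSpace, ΩG a b = BoundaryData.centralTerm s (π a) (π b)) ∧
      IsTwoCocycle brB ΩB ∧ IsCentralExtension brB ΩB ∧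
      IsTwoCocycle brG ΩG ∧ IsCentralExtension brG ΩG := by
  have hπ : ∀ a b : smearingSpace, SmearingField.boundaryDataₗ (SmearingField.bracketₗ a b) =
      boundaryBracketₗ (SmearingField.boundaryDataₗ a) (SmearingField.boundaryDataₗ b) :=
    fun a b => (boundaryBracketₗ_boundaryDataₗ a b).symm
  have hB := isTwoCocycle_centralTermₗ s
  have hG := hB.comp hπ
  exact ⟨boundaryBracketₗ, SmearingField.bracketₗ, SmearingField.boundaryDataₗ, centralTermₗ s,
    (centralTermₗ s).compl₁₂ SmearingField.boundaryDataₗ SmearingField.boundaryDataₗ,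
    fun _ _ => rfl, fun _ _ => rfl, SmearingField.hasBoundaryData_iff_eq, hπ, fun _ _ => rfl,
    fun _ _ => rfl, hB, hB.isCentralExtension isLieBracket_boundaryBracketₗ,
    hG, hG.isCentralExtension SmearingField.isLieBracket_bracketₗ⟩
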